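/- Let $c_0$ and $\ell_1$ be the usual real sequence spaces and $e_{n,m}$ the unit vectors of $\ell_1(\mathbb N\times\mathbb N)$, $\mathbb N=\{1,2,\dots\}$. For a real Banach space $X$ let $X^*$, $B_X$, $S_X$ be its dual, closed unit ball and unit sphere, and let $NA(X)\subset X^*$ be the set of functionals $f$ with $|f(x)|=\|f\|$ for some $x\in S_X$. An operator range is the image of an infinite-dimensional Banach space under a bounded injective operator. *Construction of $\mathbb X$.* Choose - an equivalent norm $|||\cdot|||$ on $c_0$ that is smooth (every unit vector has exactly one norm-one supporting functional) and satisfies $NA((c_0,|||\cdot|||))=NA(c_0)$; - a separable operator range $Y$, dense in $(c_0,|||\cdot|||)^*$, with $NA((c_0,|||\cdot|||))\cap Y=\{0\}$; - an injective operator $T\colon\ell_1(\mathbb N\times\mathbb N)\to (c_0,|||\cdot|||)^*$ of norm one with values in $Y$ such that, writing $v^*_{n,m}=T(e_{n,m})$, for every $m$ the set $\{v^*_{n,m}/|||v^*_{n,m}|||: n\in\mathbb N\}$ is dense in $S_Y$ ($Y$ carrying the dual norm of $|||\cdot|||$). Put $\Phi_m(n)=2^{-m}2^{-n}|||v^*_{n,m}|||$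 and let $|\cdot|_m$ be the norm on $\ell_1$ whose unit ball is $B_{\ell_1}+\{(\Phi_m(n)a(n))_n: a\in B_{\ell_2}\}$. Let $[R_m(x)](n)=\frac{m}{2^m}\frac1{2^n}v^*_{n,m}(x)$ for $x\in c_0$, and $$p(x)=|||x|||+\sum_{m=1}^\infty|R_m(x)|_m ,\qquad \mathbb X=(c_0,p).$$ **Proposition.** Such choices exist, and for every choice the resulting space $\mathbb X$ has the following properties. Let $M$ be a closed subspace of $\mathbb X$ of codimension two, $\pi_M\colon\mathbb X\to\mathbb X/M$ the quotient map, $\mathbb X/M$ carrying the quotient norm, and $P_M(x)=\{m\in M:\|x-m\|=\mathrm{dist}(x,M)\}$. Then: (a) The set $\{x\in B_{\mathbb X}:\pi_M(x)\in S_{\mathbb X/M}\}$ contains at most two elements and their opposites, that is, it is contained in $\{x_1,x_2,-x_1,-x_2\}$ for some $x_1,x_2\in B_{\mathbb X}$. (b) There are $x_1,x_2\in B_{\mathbb X}$ with $\pi_M(B_{\mathbb X})\cap S_{\mathbb X/M}\subseteq\{x_1+M,\,x_2+M,\,-x_1+M,\,-x_2+M\}$; in particular $\pi_M(B_{\mathbb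 X})\cap S_{\mathbb X/M}$ has at most four points. (c) There are $x_1,x_2\in\mathbb X\setminus M$ such that the (possibly empty) set $\{x+M: x\in\mathbb X\setminus M,\ P_M(x)\neq\emptyset\}$ is contained in the union $\mathbb R(x_1+M)\cup\mathbb R(x_2+M)$ of two lines of $\mathbb X/M$. -/

import Mathlib

open scoped ZeroAtInfty Pointwise

noncomputable section

namespace AlgTrivNA

/-! ### General notions for a real normed space -/

section General

variable {E : Type*} [NormedAddCommGroup E] [NormedSpace ℝ E]

/-- The set `NA(E, ℝ)` of norm-attaining functionals. -/
def normAttaining (E : Type*) [NormedAddCommGroup E] [NormedSpace ℝ E] : Set (StrongDual ℝ E) :=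
  {f | ∃ x : E, ‖x‖ = 1 ∧ |f x| = ‖f‖}

/-- The norm of `E` is smooth: every point of the unit sphere has only one
supporting functional of norm one. -/
def IsSmoothNorm (E : Type*) [NormedAddCommGroup E] [NormedSpace ℝ E] : Prop :=
  ∀ x : E, ‖x‖ = 1 → ∀ f g : StrongDual ℝ E,
    ‖f‖ = 1 → ‖g‖ = 1 → f x = 1 → g x = 1 → f = g

/-- `Y` is an operator range: the image of an infinite-dimensional Banach space
under a bounded injective operator. -/
def IsOperatorRange (Y : Submodule ℝ E) : Prop :=
  ∃ (F : Type) (_ : NormedAddCommGroup F) (_ : NormedSpace ℝ F),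
    CompleteSpace F ∧ ¬ FiniteDimensional ℝ F ∧
      ∃ j : F →L[ℝ] E, Function.Injective j ∧ Set.range j = Y

/-- `P_M(x)`: the set of nearest points to `x` in `M`. -/
def nearestPoints (M : Submodule ℝ E) (x : E) : Set E :=
  {m | m ∈ M ∧ ‖x - m‖ = Metric.infDist x (M : Set E)}

end General

/-! ### Equivalent renormings -/

/-- A norm on the vector space `E` that is equivalent to the given one. -/
structure EquivNorm (E : Type*) [NormedAddCommGroup E] [NormedSpace ℝ E] extends
    Seminorm ℝ E where
  lower' : ∃ c : ℝ, 0 < c ∧ ∀ x, c * ‖x‖ ≤ toFun x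
  upper' : ∃ C : ℝ, ∀ x, toFun x ≤ C * ‖x‖

/-- The vector space `E` endowed with the equivalent norm `p`. -/
def Renormed {E : Type*} [NormedAddCommGroup E] [NormedSpace ℝ E] (_p : EquivNorm E) :
    Type _ := E

namespace Renormed

variable {E : Type*} [NormedAddCommGroup E] [NormedSpace ℝ E] (p : EquivNorm E)

instance : AddCommGroup (Renormed p) := inferInstanceAs (AddCommGroup E)

instance : Module ℝ (Renormed p) := inferInstanceAs (Module ℝ E)

/-- The identity map from `(E, p)` to `E`, as a linear equivalence. -/
def toBaseₗ : Renormed p ≃ₗ[ℝ] E := LinearEquiv.refl ℝ E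

instance : Norm (Renormed p) := ⟨fun x => p.toSeminorm (toBaseₗ p x)⟩

theorem norm_def (x : Renormed p) : ‖x‖ = p.toSeminorm (toBaseₗ p x) := rfl

theorem core : NormedSpace.Core ℝ (Renormed p) where
  norm_nonneg x := apply_nonneg p.toSeminorm _
  norm_smul c x := by simp only [norm_def, map_smul, map_smul_eq_mul]
  norm_triangle x y := by
    simp only [norm_def, map_add]
    exact map_add_le_add p.toSeminorm _ _
  norm_eq_zero_iff x := by
    constructor
    · intro h
      obtain ⟨c, hc, hl⟩ := p.lower'
      have h1 : c * ‖toBaseₗ p x‖ ≤ 0 := (hl _).trans h.le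
      have h2 : ‖toBaseₗ p x‖ ≤ 0 := by
        by_contra! h3
        exact absurd h1 (not_le.2 (mul_pos hc h3))
      simpa using h2
    · rintro rfl
      simp [norm_def]

instance : NormedAddCommGroup (Renormed p) := NormedAddCommGroup.ofCore (core p)

instance : NormedSpace ℝ (Renormed p) := NormedSpace.ofCore (core p)

/-- The identity map from `(E, p)` to `E`, as an isomorphism of normed spaces. -/
def toBase : Renormed p ≃L[ℝ] E where
  toLinearEquiv := toBaseₗ p
  continuous_toFun := by
    obtain ⟨c, hc, hl⟩ := p.lower'
    refine AddMonoidHomClass.continuous_of_bound (toBaseₗ p) c⁻¹ fun x => ?_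
    rw [inv_mul_eq_div, le_div_iff₀ hc, mul_comm]
    exact hl _
  continuous_invFun := by
    obtain ⟨C, hu⟩ := p.upper'
    exact AddMonoidHomClass.continuous_of_bound (toBaseₗ p).symm C fun x => hu x

instance [CompleteSpace E] : CompleteSpace (Renormed p) :=
  (completeSpace_congr (e := (toBase p).toEquiv) (toBase p).isUniformEmbedding).2 inferInstance

end Renormed

/-! ### The norms `|·|_Φ` on `ℓ₁` -/

/-- The real Banach space `ℓ₁` over the index set `ι`. -/
abbrev Ell1 (ι : Type) : Type := lp (fun _ : ι => ℝ) 1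

/-- The real Hilbert space `ℓ₂`. -/
abbrev Ell2 : Type := lp (fun _ : ℕ => ℝ) 2

/-- The set `B_{ℓ₁} + S_Φ(B_{ℓ₂})`, where `[S_Φ a](n) = Φ(n) a(n)`. -/
def phiBall (Φ : ℕ → ℝ) : Set (Ell1 ℕ) :=
  Metric.closedBall 0 1 + {x | ∃ a : Ell2, ‖a‖ ≤ 1 ∧ ∀ n, x n = Φ n * a n}

theorem closedBall_subset_phiBall (Φ : ℕ → ℝ) :
    Metric.closedBall (0 : Ell1 ℕ) 1 ⊆ phiBall Φ := fun x hx =>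
  ⟨x, hx, 0, ⟨0, by simp, by simp⟩, by simp⟩

theorem phiBall_balanced (Φ : ℕ → ℝ) : Balanced ℝ (phiBall Φ) := by
  refine Balanced.add ?_ ?_
  · exact balanced_closedBall_zero
  · rw [balanced_iff_smul_mem]
    rintro c hc x ⟨a, ha, hx⟩
    refine ⟨c • a, ?_, fun n => ?_⟩
    · rw [norm_smul]
      exact mul_le_one₀ hc (norm_nonneg _) ha
    · simp only [lp.coeFn_smul, Pi.smul_apply, smul_eq_mul, hx n]
      ring

theorem phiBall_convex (Φ : ℕ → ℝ) : Convex ℝ (phiBall Φ) := by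
  refine (convex_closedBall _ _).add ?_
  rintro x ⟨a, ha, hx⟩ y ⟨b, hb, hy⟩ s t hs ht hst
  refine ⟨s • a + t • b, ?_, fun n => ?_⟩
  · have := (convex_closedBall (0 : Ell2) 1) (by simpa using ha) (by simpa using hb) hs ht hst
    simpa using this
  · simp only [lp.coeFn_add, lp.coeFn_smul, Pi.add_apply, Pi.smul_apply, smul_eq_mul, hx n, hy n]
    ring

theorem phiBall_absorbent (Φ : ℕ → ℝ) : Absorbent ℝ (phiBall Φ) :=
  (absorbent_nhds_zero (Metric.closedBall_mem_nhds (0 : Ell1 ℕ) one_pos)).mono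
    (closedBall_subset_phiBall Φ)

/-- The norm `|·|_Φ` on `ℓ₁`: the Minkowski functional of `B_{ℓ₁} + S_Φ(B_{ℓ₂})`. -/
def phiNorm (Φ : ℕ → ℝ) : Seminorm ℝ (Ell1 ℕ) :=
  gaugeSeminorm (phiBall_balanced Φ) (phiBall_convex Φ) (phiBall_absorbent Φ)

theorem phiNorm_le (Φ : ℕ → ℝ) (x : Ell1 ℕ) : phiNorm Φ x ≤ ‖x‖ := by
  have h := gauge_mono (absorbent_nhds_zero (𝕜 := ℝ)
    (Metric.closedBall_mem_nhds (0 : Ell1 ℕ) one_pos)) (closedBall_subset_phiBall Φ) x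
  rw [gauge_closedBall zero_le_one, div_one] at h
  exact h

/-! ### The construction of the space -/

/-- The real Banach space `c₀` with the supremum norm. -/
abbrev C0 : Type := C₀(ℕ, ℝ)

/-- The choices from which the space `𝕏` is built. -/
structure Choices where
  /-- A smooth equivalent norm on `c₀` with the same norm-attaining functionals as `c₀`. -/
  nrm : EquivNorm C0
  smooth : IsSmoothNorm (Renormed nrm)
  na_iff : ∀ f : StrongDual ℝ C0,
    f.comp (Renormed.toBase nrm : Renormed nrm →L[ℝ] C0) ∈ normAttaining (Renormed nrm) ↔
      f ∈ normAttaining C0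
  /-- A dense separable operator range in the dual that contains no non-zero
  norm-attaining functional. -/
  Y : Submodule ℝ (StrongDual ℝ (Renormed nrm))
  Y_range : IsOperatorRange Y
  Y_separable : TopologicalSpace.IsSeparable (Y : Set (StrongDual ℝ (Renormed nrm)))
  Y_dense : Dense (Y : Set (StrongDual ℝ (Renormed nrm)))
  Y_na : normAttaining (Renormed nrm) ∩ (Y : Set (StrongDual ℝ (Renormed nrm))) = {0}
  /-- An injective norm-one operator from `ℓ₁(ℕ × ℕ)` into `Y` such that, for every `m`, the
  normalised vectors `T e_{n,m}`, `n ∈ ℕ`, are dense in the unit sphere of `Y`. -/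
  T : Ell1 (ℕ × ℕ) →L[ℝ] StrongDual ℝ (Renormed nrm)
  T_injective : Function.Injective T
  T_norm : ‖T‖ = 1
  T_mem : ∀ a, T a ∈ Y
  T_dense : ∀ m : ℕ, {f | f ∈ Y ∧ ‖f‖ = 1} ⊆
    closure (Set.range fun n : ℕ =>
      ‖T (lp.single 1 (n, m) (1 : ℝ))‖⁻¹ • T (lp.single 1 (n, m) (1 : ℝ)))

namespace Choices

variable (D : Choices)

/-- The functional `v*_{n,m} = T e_{n,m}`. -/
def v (n m : ℕ) : StrongDual ℝ (Renormed D.nrm) := D.T (lp.single 1 (n, m) (1 : ℝ))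

theorem norm_v_le (n m : ℕ) : ‖D.v n m‖ ≤ 1 := by
  refine (D.T.le_opNorm _).trans ?_
  rw [D.T_norm, lp.norm_single (by simp)]
  simp

/-- The sequence `Φ_m(n) = 2^{-m} 2^{-n} ‖v*_{n,m}‖`; since indices start from zero here, both
exponents are shifted by one. -/
def Φ (m n : ℕ) : ℝ := 1 / 2 ^ (m + 1) * (1 / 2 ^ (n + 1)) * ‖D.v n m‖

/-- The `n`-th coordinate `(m / 2^m) 2^{-n} v*_{n,m}(x)` of `R_m x`, with the same shift. -/
def Rcoord (m : ℕ) (x : Renormed D.nrm) (n : ℕ) : ℝ :=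
  ((m : ℝ) + 1) / 2 ^ (m + 1) * (1 / 2 ^ (n + 1)) * D.v n m x

theorem abs_Rcoord_le (m : ℕ) (x : Renormed D.nrm) (n : ℕ) :
    ‖D.Rcoord m x n‖ ≤ ((m : ℝ) + 1) / 2 ^ (m + 1) * ‖x‖ * (1 / 2 / 2 ^ n) := by
  have h1 : ‖D.v n m x‖ ≤ ‖x‖ := by
    refine ((D.v n m).le_opNorm x).trans ?_
    exact mul_le_of_le_one_left (norm_nonneg _) (D.norm_v_le n m)
  rw [Rcoord, norm_mul, Real.norm_of_nonneg (by positivity)]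
  calc ((m : ℝ) + 1) / 2 ^ (m + 1) * (1 / 2 ^ (n + 1)) * ‖D.v n m x‖
      ≤ ((m : ℝ) + 1) / 2 ^ (m + 1) * (1 / 2 ^ (n + 1)) * ‖x‖ := by gcongr
    _ = ((m : ℝ) + 1) / 2 ^ (m + 1) * ‖x‖ * (1 / 2 / 2 ^ n) := by
      rw [pow_succ (2 : ℝ) n]; field_simp

theorem summable_Rcoord (m : ℕ) (x : Renormed D.nrm) : Summable fun n => ‖D.Rcoord m x n‖ :=
  Summable.of_nonneg_of_le (fun _ => norm_nonneg _) (D.abs_Rcoord_le m x)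
    ((summable_geometric_two' 1).mul_left _)

/-- The operator `R_m : (c₀, nrm) → ℓ₁`. -/
def R (m : ℕ) : Renormed D.nrm →ₗ[ℝ] Ell1 ℕ where
  toFun x := ⟨D.Rcoord m x, memℓp_gen (by simpa using D.summable_Rcoord m x)⟩
  map_add' x y := by
    ext n
    simp only [Rcoord, map_add, lp.coeFn_add, Pi.add_apply]
    ring
  map_smul' c x := by
    ext n
    simp only [Rcoord, map_smul, smul_eq_mul, lp.coeFn_smul, Pi.smul_apply, RingHom.id_apply]
    ring

theorem norm_R_le (m : ℕ) (x : Renormed D.nrm) :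
    ‖D.R m x‖ ≤ ((m : ℝ) + 1) / 2 ^ (m + 1) * ‖x‖ := by
  rw [lp.norm_eq_tsum_rpow (by simp)]
  simp only [ENNReal.toReal_one, Real.rpow_one, div_one]
  refine (Summable.tsum_le_tsum (D.abs_Rcoord_le m x) (D.summable_Rcoord m x)
    ((summable_geometric_two' 1).mul_left _)).trans ?_
  rw [tsum_mul_left, tsum_geometric_two' 1, mul_one]

theorem summable_weights : Summable fun m : ℕ => ((m : ℝ) + 1) / 2 ^ (m + 1) := by
  have h := summable_pow_mul_geometric_of_norm_lt_one 1 (r := (1 / 2 : ℝ))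
    (by norm_num)
  refine ((summable_nat_add_iff 1).2 h).congr fun m => ?_
  simp [div_eq_mul_inv]

theorem phiNorm_R_le (m : ℕ) (x : Renormed D.nrm) :
    phiNorm (D.Φ m) (D.R m x) ≤ ((m : ℝ) + 1) / 2 ^ (m + 1) * ‖x‖ :=
  (phiNorm_le _ _).trans (D.norm_R_le m x)

theorem summable_phiNorm_R (x : Renormed D.nrm) :
    Summable fun m => phiNorm (D.Φ m) (D.R m x) :=
  Summable.of_nonneg_of_le (fun _ => apply_nonneg _ _) (fun m => D.phiNorm_R_le m x)
    (summable_weights.mul_right _)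

/-- `‖R x‖_W = ∑ₘ |R_m x|_m`. -/
def normR (x : Renormed D.nrm) : ℝ := ∑' m, phiNorm (D.Φ m) (D.R m x)

theorem normR_le (x : Renormed D.nrm) :
    D.normR x ≤ (∑' m : ℕ, ((m : ℝ) + 1) / 2 ^ (m + 1)) * ‖x‖ := by
  rw [normR, ← tsum_mul_right]
  exact Summable.tsum_le_tsum (fun m => D.phiNorm_R_le m x) (D.summable_phiNorm_R x)
    (summable_weights.mul_right _)

theorem normR_nonneg (x : Renormed D.nrm) : 0 ≤ D.normR x :=
  tsum_nonneg fun _ => apply_nonneg _ _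

/-- `p(x) = ‖x‖ + ‖R x‖_W` on `(c₀, nrm)`, as a seminorm. -/
def pSeminorm : Seminorm ℝ (Renormed D.nrm) :=
  Seminorm.of (fun x => ‖x‖ + D.normR x)
    (by
      intro x y
      have h : D.normR (x + y) ≤ D.normR x + D.normR y := by
        rw [normR, normR, normR, ← (D.summable_phiNorm_R x).tsum_add (D.summable_phiNorm_R y)]
        refine Summable.tsum_le_tsum (fun m => ?_) (D.summable_phiNorm_R _)
          ((D.summable_phiNorm_R x).add (D.summable_phiNorm_R y))
        rw [map_add]
        exact map_add_le_add _ _ _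
      linarith [norm_add_le x y])
    (by
      intro c x
      have h : D.normR (c • x) = ‖c‖ * D.normR x := by
        rw [normR, normR, ← tsum_mul_left]
        simp only [map_smul, map_smul_eq_mul]
      rw [h, norm_smul, mul_add])

/-- The equivalent norm `p(x) = nrm(x) + ‖R x‖_W` on `c₀`. -/
def p : EquivNorm C0 where
  toSeminorm := D.pSeminorm.comp (Renormed.toBaseₗ D.nrm).symm.toLinearMap
  lower' := by
    obtain ⟨c, hc, hl⟩ := D.nrm.lower'
    exact ⟨c, hc, fun x => (hl x).trans
      (le_add_of_nonneg_right (D.normR_nonneg ((Renormed.toBaseₗ D.nrm).symm x)))⟩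
  upper' := by
    obtain ⟨C, hu⟩ := D.nrm.upper'
    refine ⟨C + (∑' m : ℕ, ((m : ℝ) + 1) / 2 ^ (m + 1)) * C, fun x => ?_⟩
    have h1 : ‖(Renormed.toBaseₗ D.nrm).symm x‖ ≤ C * ‖x‖ := hu x
    have h2 := D.normR_le ((Renormed.toBaseₗ D.nrm).symm x)
    have h3 : (0 : ℝ) ≤ ∑' m : ℕ, ((m : ℝ) + 1) / 2 ^ (m + 1) :=
      tsum_nonneg fun m => by positivity
    have h4 := mul_le_mul_of_nonneg_left h1 h3
    have h5 : ‖(Renormed.toBaseₗ D.nrm).symm x‖ + D.normR ((Renormed.toBaseₗ D.nrm).symm x) ≤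
        (C + (∑' m : ℕ, ((m : ℝ) + 1) / 2 ^ (m + 1)) * C) * ‖x‖ := by
      rw [add_mul, mul_assoc]; linarith
    exact h5

/-- The Banach space `𝕏 = (c₀, p)`. -/
abbrev X : Type := Renormed D.p

end Choices

end AlgTrivNA

end

/-! Suppose that x₁, x₂, x₃ in the unit ball have classes of norm one in 𝕏/M. Norm-one functionals
supporting these classes live in the two-dimensional dual of 𝕏/M, so their pullbacks f₁, f₂, f₃
satisfy a nontrivial relation ∑ aᵢ fᵢ = 0. By Hahn-Banach each fᵢ splits as uᵢ + T bᵢ, where uᵢ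
supports |||·||| at xᵢ and bᵢ collects the functionals supporting |·|_m at R_m xᵢ
(`exists_decomp_of_supports`, `exists_normAttaining_add_of_supports`). Norm-attaining functionals
are the finitely supported ones, hence form a vector space, so ∑ aᵢ uᵢ = -T(∑ aᵢ bᵢ) lies in NA ∩ Y
= {0}. Injectivity of T gives ∑ aᵢ bᵢ = 0, coordinate by coordinate.

These coordinates know signs: bᵢ(n,0) is 2⁻ⁿ sᵢ times the sign of v*_{n,0}(xᵢ), with sᵢ > 0
independent of n, unless |v*_{n,0}(xᵢ)| is at most a constant times 2⁻ⁿ|||v*_{n,0}|||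
(`exists_sign_of_supports_phiNorm`). The directions of the v*_{n,0} with n large are dense, so ∑ aᵢ
sᵢ sign g(xᵢ) = 0 for every g vanishing at none of the xᵢ (`exists_pos_sum_sign_eq_zero`). If aᵢ ≠ 0
and neither other point were a multiple of xᵢ, some h would vanish at xᵢ only; perturbing h to both
sides flips the i-th sign alone and gives aᵢ sᵢ = 0, a contradiction. So among three such points two
agree up to sign, which is (a). Part (b) is its image in the quotient, and (c) follows because x -
m, for m nearest to x in M, is a multiple of a point considered in (a).

For existence, |||·||| has unit ball B_{c₀} + {(2⁻ⁿ aₙ) : a ∈ B_{ℓ₂}}. A functional is maximal on a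
sum exactly where it is maximal on both summands; the ellipsoid determines its direction
(smoothness) and, being compact, does not affect norm attainment. The operator T sends unit vectors
to small multiples of truncations of a dense sequence, perturbed along disjoint infinite sets so
that no non-zero T a has finite support; Y is its range. -/

namespace AlgTrivNA

open Filter Topology Metric

/-! ### The unit ball of ℓ₂ in the product topology -/

/-- The unit ball of `ℓ₂`, as a set of sequences. -/
def ellBall : Set (ℕ → ℝ) := {a | ∀ s : Finset ℕ, ∑ n ∈ s, a n ^ 2 ≤ 1}

theorem abs_le_one_of_mem_ellBall {a : ℕ → ℝ} (ha : a ∈ ellBall) (n : ℕ) : |a n| ≤ 1 := by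
  have h := ha {n}
  rw [Finset.sum_singleton] at h
  exact (sq_le_one_iff_abs_le_one _).1 h

/-- Conditions on finite partial sums are closed for pointwise convergence, so Tychonoff's theorem
applies inside the cube [-1, 1]^ℕ. -/
theorem isCompact_ellBall : IsCompact ellBall := by
  refine (isCompact_univ_pi fun _ : ℕ => isCompact_Icc (a := (-1 : ℝ)) (b := 1)).of_isClosed_subset
    ?_ fun a ha n _ => abs_le.1 (abs_le_one_of_mem_ellBall ha n)
  have : ellBall = ⋂ s : Finset ℕ, {a : ℕ → ℝ | ∑ n ∈ s, a n ^ 2 ≤ 1} := by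
    ext a; simp [ellBall]
  rw [this]
  exact isClosed_iInter fun s => isClosed_le (by fun_prop) continuous_const

theorem mem_ellBall_iff (a : ℕ → ℝ) : a ∈ ellBall ↔ ∃ x : lp (fun _ : ℕ => ℝ) 2, ‖x‖ ≤ 1 ∧ ⇑x = a := by
  constructor
  · intro ha
    refine ⟨⟨a, memℓp_gen' (C := 1) fun s => by simpa using ha s⟩, ?_, rfl⟩
    exact lp.norm_le_of_forall_sum_le (by simp) zero_le_one fun s => by simpa using ha s
  · rintro ⟨x, hx, rfl⟩ s
    have h := lp.sum_rpow_le_norm_rpow (p := 2) (by simp) x s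
    simp only [ENNReal.toReal_ofNat, Real.rpow_ofNat, Real.norm_eq_abs, sq_abs] at h
    exact h.trans (pow_le_one₀ (norm_nonneg _) hx)

theorem balanced_ellBall : Balanced ℝ ellBall := by
  rw [balanced_iff_smul_mem]
  intro c hc a ha
  obtain ⟨x, hx, rfl⟩ := (mem_ellBall_iff a).1 ha
  refine (mem_ellBall_iff _).2 ⟨c • x, ?_, by simp⟩
  rw [norm_smul]
  exact mul_le_one₀ hc (norm_nonneg _) hx

theorem convex_ellBall : Convex ℝ ellBall := by
  intro a ha b hb s t hs ht hst
  obtain ⟨x, hx, rfl⟩ := (mem_ellBall_iff a).1 ha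
  obtain ⟨y, hy, rfl⟩ := (mem_ellBall_iff b).1 hb
  refine (mem_ellBall_iff _).2 ⟨s • x + t • y, ?_, rfl⟩
  have := (convex_closedBall (0 : lp (fun _ : ℕ => ℝ) 2) 1) (by simpa using hx) (by simpa using hy)
    hs ht hst
  simpa using this

theorem zero_mem_ellBall : (0 : ℕ → ℝ) ∈ ellBall := fun s => by simp

/-- Equality case of the Cauchy-Schwarz inequality: a point of the unit ball of `ℓ₂` at which
a functional attains its maximum is proportional to this functional. -/
theorem exists_eq_mul_of_isMaxOn_ellBall {a c : ℕ → ℝ} (ha : a ∈ ellBall)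
    (hc : Summable fun n => |c n|)
    (hmax : ∀ b ∈ ellBall, ∑' n, b n * c n ≤ ∑' n, a n * c n) :
    ∃ l : ℝ, 0 ≤ l ∧ ∀ n, c n = l * a n := by
  obtain ⟨x, hx, rfl⟩ := (mem_ellBall_iff a).1 ha
  have h1 : Memℓp c 1 := memℓp_gen (by simpa using hc)
  set y : lp (fun _ : ℕ => ℝ) 2 := ⟨c, h1.of_exponent_ge (by norm_num)⟩ with hy
  have hyc : ∀ n, y n = c n := fun _ => rfl
  have hin : ∀ z : lp (fun _ : ℕ => ℝ) 2, inner ℝ z y = ∑' n, z n * c n := fun z => by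
    rw [lp.inner_eq_tsum]
    refine tsum_congr fun n => ?_
    rw [hyc]; simp [mul_comm]
  refine ⟨‖y‖, norm_nonneg _, ?_⟩
  by_cases hy0 : y = 0
  · intro n
    rw [← hyc, hy0]; simp
  have hyn : 0 < ‖y‖ := norm_pos_iff.2 hy0
  have h2 := hmax (⇑(‖y‖⁻¹ • y)) ((mem_ellBall_iff _).2 ⟨_, by
    rw [norm_smul, norm_inv, norm_norm, inv_mul_cancel₀ hyn.ne'], rfl⟩)
  rw [← hin, ← hin, real_inner_smul_left, real_inner_self_eq_norm_sq] at h2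
  have h3 : ‖y‖ ≤ inner ℝ x y := by
    refine le_trans (le_of_eq ?_) h2
    field_simp
  -- The square expands to ‖y‖² - 2‖y‖⟨x, y⟩ + ‖y‖²‖x‖², where ⟨x, y⟩ ≥ ‖y‖ and ‖x‖ ≤ 1.
  have h4 : ‖y - ‖y‖ • x‖ ^ 2 ≤ 0 := by
    rw [norm_sub_sq_real, real_inner_smul_right, norm_smul, norm_norm, real_inner_comm]
    have h5 : ‖x‖ ^ 2 ≤ 1 := pow_le_one₀ (norm_nonneg _) hx
    nlinarith [mul_le_mul_of_nonneg_left h3 hyn.le, mul_le_mul_of_nonneg_left h5 (sq_nonneg ‖y‖)]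
  have h6 : y - ‖y‖ • x = 0 := by
    rw [← norm_eq_zero]
    exact pow_eq_zero_iff two_ne_zero |>.1 (le_antisymm h4 (sq_nonneg _))
  intro n
  rw [← hyc]
  have h7 : y = ‖y‖ • x := sub_eq_zero.1 h6
  conv_lhs => rw [h7]
  simp

/-! ### Sums of a ball and a compact ellipsoid -/

section BallPlus

variable {E : Type*} [NormedAddCommGroup E] [NormedSpace ℝ E]

/-- The image of the unit ball of `ℓ₂` under `a ↦ ∑ aₙ tₙ`. -/
def ellHull (t : ℕ → E) : Set E := (fun a : ℕ → ℝ => ∑' n, a n • t n) '' ellBall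

/-- The sum of the closed unit ball and of the image of the unit ball of `ℓ₂` under
`a ↦ ∑ aₙ tₙ`. -/
def ballPlus (t : ℕ → E) : Set E := closedBall 0 1 + ellHull t

variable {t : ℕ → E}

theorem norm_smul_le_of_mem_ellBall {a : ℕ → ℝ} (ha : a ∈ ellBall) (t : ℕ → E) (n : ℕ) :
    ‖a n • t n‖ ≤ ‖t n‖ := by
  rw [norm_smul]
  exact mul_le_of_le_one_left (norm_nonneg _) (abs_le_one_of_mem_ellBall ha n)

theorem summable_smul_of_mem_ellBall [CompleteSpace E] (ht : Summable fun n => ‖t n‖) {a : ℕ → ℝ}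
    (ha : a ∈ ellBall) : Summable fun n => a n • t n :=
  Summable.of_norm_bounded ht (norm_smul_le_of_mem_ellBall ha t)

/-- The series converges uniformly on `ellBall`, so its sum is continuous for pointwise convergence.
-/
theorem isCompact_ellHull [CompleteSpace E] (ht : Summable fun n => ‖t n‖) : IsCompact (ellHull t) := by
  refine isCompact_ellBall.image_of_continuousOn (continuousOn_tsum (fun n => ?_) ht fun n a ha =>
    norm_smul_le_of_mem_ellBall ha t n)
  exact Continuous.continuousOn (by fun_prop)

theorem isClosed_ballPlus [CompleteSpace E] (ht : Summable fun n => ‖t n‖) : IsClosed (ballPlus t) :=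
  isClosed_closedBall.add_right_of_isCompact (isCompact_ellHull ht)

theorem balanced_ballPlus : Balanced ℝ (ballPlus t) := by
  refine Balanced.add balanced_closedBall_zero ?_
  rw [balanced_iff_smul_mem]
  rintro c hc _ ⟨a, ha, rfl⟩
  refine ⟨c • a, balanced_iff_smul_mem.1 balanced_ellBall hc ha, ?_⟩
  simp only [Pi.smul_apply, smul_assoc]
  exact tsum_const_smul'' c

theorem convex_ballPlus [CompleteSpace E] (ht : Summable fun n => ‖t n‖) : Convex ℝ (ballPlus t) := by
  refine (convex_closedBall _ _).add ?_
  rintro _ ⟨a, ha, rfl⟩ _ ⟨b, hb, rfl⟩ r s hr hs hrs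
  refine ⟨r • a + s • b, convex_ellBall ha hb hr hs hrs, ?_⟩
  simp only [Pi.add_apply, Pi.smul_apply, add_smul, smul_assoc]
  rw [Summable.tsum_add, tsum_const_smul'', tsum_const_smul'']
  · exact (summable_smul_of_mem_ellBall ht ha).const_smul r
  · exact (summable_smul_of_mem_ellBall ht hb).const_smul s

theorem closedBall_subset_ballPlus : closedBall (0 : E) 1 ⊆ ballPlus t := fun x hx =>
  ⟨x, hx, 0, ⟨0, zero_mem_ellBall, by simp⟩, by simp⟩

theorem ballPlus_mem_nhds : ballPlus t ∈ 𝓝 (0 : E) :=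
  mem_of_superset (closedBall_mem_nhds 0 one_pos) closedBall_subset_ballPlus

/-- A closed set plus a compact set is closed, so a vector of gauge at most one has an actual
decomposition, with no limit to take. -/
theorem mem_ballPlus_of_gauge_le_one [CompleteSpace E] (ht : Summable fun n => ‖t n‖) {x : E}
    (hx : gauge (ballPlus t) x ≤ 1) : x ∈ ballPlus t := by
  rw [gauge_le_one_iff_mem_closure (convex_ballPlus ht) ballPlus_mem_nhds,
    (isClosed_ballPlus ht).closure_eq] at hx
  exact hx

/-- The structure of a functional which attains its maximum on `ballPlus t` at a given point. -/
theorem apply_eq_of_isMaxOn_ballPlus [CompleteSpace E] (ht : Summable fun n => ‖t n‖) {b : E}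
    {a : ℕ → ℝ} (hbn : ‖b‖ ≤ 1) (ha : a ∈ ellBall) (f : StrongDual ℝ E)
    (hmax : ∀ y ∈ ballPlus t, f y ≤ f (b + ∑' n, a n • t n)) :
    f b = ‖f‖ ∧ ∃ l : ℝ, 0 ≤ l ∧ ∀ n, f (t n) = l * a n := by
  have hb : b ∈ closedBall (0 : E) 1 := by simpa using hbn
  constructor
  · refine le_antisymm ?_ ?_
    · exact (le_abs_self _).trans ((f.le_opNorm b).trans (mul_le_of_le_one_right (norm_nonneg _) hbn))
    -- Only the ball summand moves here; below, only the ellipsoid summand moves.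
    · have h0 : ∀ y : E, ‖y‖ ≤ 1 → f y ≤ f b := fun y hy => by
        have := hmax (y + ∑' n, a n • t n) ⟨y, by simpa using hy, _, ⟨a, ha, rfl⟩, rfl⟩
        simp only [map_add] at this
        linarith
      refine f.opNorm_le_of_unit_norm ?_ fun y hy => ?_
      · have := h0 0 (by simp); simpa using this
      · refine abs_le.2 ⟨?_, h0 y hy.le⟩
        have := h0 (-y) (by simp [hy])
        rw [map_neg] at this; linarith
  · have hs : ∀ c ∈ ellBall, f (∑' n, c n • t n) = ∑' n, c n * f (t n) := fun c hc => by
      rw [f.map_tsum (summable_smul_of_mem_ellBall ht hc)]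
      simp
    refine exists_eq_mul_of_isMaxOn_ellBall ha ?_ fun c hc => ?_
    · refine Summable.of_nonneg_of_le (fun _ => abs_nonneg _) (fun n => f.le_opNorm (t n))
        (ht.mul_left _)
    · have := hmax (b + ∑' n, c n • t n) ⟨b, hb, _, ⟨c, hc, rfl⟩, rfl⟩
      simp only [map_add] at this
      rw [← hs c hc, ← hs a ha]
      linarith

end BallPlus

/-! ### Dual bases -/

section GeneralDual

variable {E : Type*} [NormedAddCommGroup E] [NormedSpace ℝ E]

theorem norm_dual_pos {f : StrongDual ℝ E} (hf : f ≠ 0) : 0 < ‖f‖ := norm_pos_iff.2 hf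

/-- The biorthogonal functionals of a shrinking basis form a basis of the dual. -/
theorem hasSum_apply_smul_dual {e : ℕ → E} {d : ℕ → StrongDual ℝ E}
    (hde : ∀ x, HasSum (fun n => d n x • e n) x) {B : ℝ} (hd : ∀ n, ‖d n‖ ≤ B)
    (f : StrongDual ℝ E) (hf : Summable fun n => |f (e n)|) :
    HasSum (fun n => f (e n) • d n) f := by
  have hs : Summable fun n => f (e n) • d n := by
    refine Summable.of_norm_bounded (hf.mul_right B) fun n => ?_
    rw [norm_smul]
    exact mul_le_mul_of_nonneg_left (hd n) (abs_nonneg _)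
  have h : ∑' n, f (e n) • d n = f := by
    ext x
    have h1 := hs.hasSum.mapL (ContinuousLinearMap.apply ℝ ℝ x)
    have h2 := (hde x).mapL f
    refine h1.unique (h2.congr_fun fun n => ?_)
    simp [mul_comm]
  have h3 := hs.hasSum
  rwa [h] at h3

end GeneralDual

/-! ### The space c₀ and its norm-attaining functionals -/

section SequenceSpace

theorem C0.norm_le {x : C0} {C : ℝ} (hC : 0 ≤ C) : ‖x‖ ≤ C ↔ ∀ n, |x n| ≤ C := by
  rw [← ZeroAtInftyContinuousMap.norm_toBCF_eq_norm, BoundedContinuousFunction.norm_le hC]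
  rfl

theorem C0.abs_apply_le (x : C0) (n : ℕ) : |x n| ≤ ‖x‖ := (C0.norm_le (norm_nonneg x)).1 le_rfl n

theorem C0.tendsto (x : C0) : Tendsto x atTop (𝓝 0) := by
  have := x.zero_at_infty'
  rw [Nat.cofinite_eq_atTop.symm, ← cocompact_eq_cofinite]
  exact this

/-- The unit vectors of `c₀`. -/
noncomputable def unitVec (n : ℕ) : C0 where
  toFun := Pi.single n 1
  continuous_toFun := continuous_of_discreteTopology
  zero_at_infty' := by
    rw [cocompact_eq_cofinite, Nat.cofinite_eq_atTop]
    refine tendsto_const_nhds.congr' ?_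
    filter_upwards [eventually_gt_atTop n] with k hk
    rw [Pi.single_eq_of_ne hk.ne']

theorem unitVec_apply (n k : ℕ) : unitVec n k = if k = n then 1 else 0 := by
  change (Pi.single n 1 : ℕ → ℝ) k = _
  rw [Pi.single_apply]

/-- The coordinate functionals of `c₀`. -/
noncomputable def coord (n : ℕ) : StrongDual ℝ C0 :=
  LinearMap.mkContinuous
    { toFun := fun x => x n
      map_add' := fun _ _ => rfl
      map_smul' := fun _ _ => rfl } 1 fun x => by
    rw [one_mul]; exact C0.abs_apply_le x n

theorem coord_apply (n : ℕ) (x : C0) : coord n x = x n := rfl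

theorem norm_coord_le (n : ℕ) : ‖coord n‖ ≤ 1 := LinearMap.mkContinuous_norm_le _ zero_le_one _

theorem sum_unitVec_apply (s : Finset ℕ) (a : ℕ → ℝ) (k : ℕ) :
    (∑ n ∈ s, a n • unitVec n) k = if k ∈ s then a k else 0 := by
  rw [← coord_apply, map_sum]
  simp [coord_apply, unitVec_apply]

theorem norm_sum_unitVec_le (s : Finset ℕ) {a : ℕ → ℝ} (ha : ∀ n, |a n| ≤ 1) :
    ‖∑ n ∈ s, a n • unitVec n‖ ≤ 1 := by
  refine (C0.norm_le zero_le_one).2 fun k => ?_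
  rw [sum_unitVec_apply]
  split_ifs
  · exact ha k
  · simp

theorem norm_unitVec_le (n : ℕ) : ‖unitVec n‖ ≤ 1 := by
  simpa using norm_sum_unitVec_le {n} (a := fun _ => 1) (by simp)

theorem hasSum_unitVec (x : C0) : HasSum (fun n => x n • unitVec n) x := by
  rw [HasSum, SummationFilter.unconditional_filter, Metric.tendsto_atTop]
  intro ε hε
  obtain ⟨N, hN⟩ := Metric.tendsto_atTop.1 x.tendsto (ε / 2) (half_pos hε)
  refine ⟨Finset.range N, fun s hs => ?_⟩
  rw [dist_eq_norm]
  refine lt_of_le_of_lt ((C0.norm_le (half_pos hε).le).2 fun k => ?_) (half_lt_self hε)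
  rw [ZeroAtInftyContinuousMap.sub_apply, sum_unitVec_apply]
  split_ifs with hk
  · simpa using (half_pos hε).le
  · have : N ≤ k := by
      by_contra! h
      exact hk (hs (Finset.mem_range.2 h))
    have := hN k this
    rw [Real.dist_0_eq_abs] at this
    simpa using this.le

variable (f : StrongDual ℝ C0)

theorem sum_abs_apply_unitVec_le (s : Finset ℕ) : ∑ n ∈ s, |f (unitVec n)| ≤ ‖f‖ := by
  have h1 : f (∑ n ∈ s, (SignType.sign (f (unitVec n)) : ℝ) • unitVec n) =
      ∑ n ∈ s, |f (unitVec n)| := by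
    rw [map_sum]
    refine Finset.sum_congr rfl fun n _ => ?_
    rw [map_smul, smul_eq_mul, sign_mul_self]
  rw [← h1]
  refine (le_abs_self _).trans ((f.le_opNorm _).trans (mul_le_of_le_one_right (norm_nonneg _) ?_))
  refine norm_sum_unitVec_le s fun n => ?_
  cases SignType.sign (f (unitVec n)) <;> simp

theorem summable_abs_apply_unitVec : Summable fun n => |f (unitVec n)| :=
  summable_of_sum_le (fun _ => abs_nonneg _) (sum_abs_apply_unitVec_le f)

/-- The norm-attaining functionals of `c₀` are those with finite support. -/
theorem mem_normAttaining_C0_iff :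
    f ∈ normAttaining C0 ↔ ∃ N, ∀ n, N ≤ n → f (unitVec n) = 0 := by
  constructor
  · rintro ⟨x, hx, hf⟩
    obtain ⟨N, hN⟩ := Metric.tendsto_atTop.1 x.tendsto (1 / 2) (by norm_num)
    refine ⟨N, fun n hn => ?_⟩
    -- Since |x n| < 1/2, moving the n-th coordinate by at most 1/2 stays in the unit ball, where
    -- |f| is maximal at x.
    have key : ∀ c : ℝ, |c| ≤ 1 / 2 → |f x + c * f (unitVec n)| ≤ |f x| := by
      intro c hc
      have h1 : ‖x + c • unitVec n‖ ≤ 1 := by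
        refine (C0.norm_le zero_le_one).2 fun k => ?_
        rw [ZeroAtInftyContinuousMap.add_apply, ZeroAtInftyContinuousMap.smul_apply, unitVec_apply]
        split_ifs with hk
        · have h2 := hN n hn
          rw [Real.dist_0_eq_abs] at h2
          rw [hk, smul_eq_mul, mul_one]
          linarith [abs_add_le (x n) c]
        · rw [smul_zero, add_zero, ← hx]
          exact C0.abs_apply_le x k
      have h3 := f.le_opNorm (x + c • unitVec n)
      rw [map_add, map_smul, smul_eq_mul, ← hf] at h3
      exact h3.trans (mul_le_of_le_one_right (abs_nonneg _) h1)
    have h1 := key (1 / 2) (by norm_num [abs_of_pos])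
    have h2 := key (-(1 / 2)) (by norm_num [abs_of_pos])
    rw [← sq_le_sq] at h1 h2
    nlinarith [sq_nonneg (f (unitVec n))]
  · rintro ⟨N, hN⟩
    -- The value at a zero of f is 1, not 0, and the sum below runs up to N rather than N - 1:
    -- coordinate 0 of x is then ±1, so ‖x‖ = 1 even when f = 0.
    set a : ℕ → ℝ := fun n => if 0 ≤ f (unitVec n) then 1 else -1 with ha
    have ha1 : ∀ n, |a n| = 1 := fun n => by
      simp only [ha]; split_ifs <;> simp
    have hax : ∀ n, a n * f (unitVec n) = |f (unitVec n)| := fun n => by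
      simp only [ha]; split_ifs with h
      · rw [abs_of_nonneg h, one_mul]
      · rw [abs_of_neg (not_le.1 h)]; ring
    set x : C0 := ∑ n ∈ Finset.range (N + 1), a n • unitVec n with hx
    have hx1 : ‖x‖ = 1 := by
      refine le_antisymm (norm_sum_unitVec_le _ fun n => (ha1 n).le) ?_
      have := C0.abs_apply_le x 0
      rw [hx, sum_unitVec_apply, if_pos (by simp), ha1] at this
      exact this
    have hfx : f x = ∑ n ∈ Finset.range (N + 1), |f (unitVec n)| := by
      rw [hx, map_sum]
      exact Finset.sum_congr rfl fun n _ => by rw [map_smul, smul_eq_mul, hax]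
    have hfx0 : 0 ≤ f x := hfx ▸ Finset.sum_nonneg fun _ _ => abs_nonneg _
    refine ⟨x, hx1, le_antisymm (by simpa [hx1] using f.le_opNorm x) ?_⟩
    rw [abs_of_nonneg hfx0]
    refine f.opNorm_le_bound hfx0 fun y => ?_
    have h1 : f y = ∑ n ∈ Finset.range (N + 1), y n * f (unitVec n) := by
      refine (f.hasSum (hasSum_unitVec y)).unique ?_
      simp only [map_smul, smul_eq_mul]
      refine hasSum_sum_of_ne_finset_zero fun n hn => ?_
      rw [hN n (by simp at hn; omega), mul_zero]
    rw [h1, hfx, Finset.sum_mul]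
    refine (Finset.abs_sum_le_sum_abs _ _).trans (Finset.sum_le_sum fun n _ => ?_)
    rw [abs_mul, mul_comm]
    exact mul_le_mul_of_nonneg_left (C0.abs_apply_le y n) (abs_nonneg _)

end SequenceSpace

/-! ### A smooth renorming of c₀ with the same norm-attaining functionals -/

section SmoothNorm

/-- The vectors `2⁻ⁿ eₙ` of `c₀`. -/
noncomputable def smallVec (n : ℕ) : C0 := (1 / 2 : ℝ) ^ n • unitVec n

theorem summable_norm_smallVec : Summable fun n => ‖smallVec n‖ := by
  refine Summable.of_nonneg_of_le (fun _ => norm_nonneg _) (fun n => ?_)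
    (summable_geometric_of_lt_one (r := (1 / 2 : ℝ)) (by norm_num) (by norm_num))
  rw [smallVec, norm_smul, Real.norm_of_nonneg (by positivity)]
  exact mul_le_of_le_one_right (by positivity) (norm_unitVec_le n)

theorem absorbent_ballPlus {E : Type*} [NormedAddCommGroup E] [NormedSpace ℝ E] (t : ℕ → E) :
    Absorbent ℝ (ballPlus t) := absorbent_nhds_zero ballPlus_mem_nhds

/-- The equivalent norm on `c₀` whose unit ball is `B_{c₀} + {(2⁻ⁿ aₙ) : a ∈ B_{ℓ₂}}`. -/
noncomputable def smoothNorm : EquivNorm C0 where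
  toSeminorm := gaugeSeminorm (s := ballPlus smallVec) balanced_ballPlus
    (convex_ballPlus summable_norm_smallVec) (absorbent_ballPlus _)
  lower' := by
    obtain ⟨r, hr⟩ := (isCompact_ellHull summable_norm_smallVec).isBounded.subset_closedBall (0 : C0)
    have hr1 : (0 : ℝ) < 1 + |r| := by positivity
    refine ⟨(1 + |r|)⁻¹, by positivity, fun x => ?_⟩
    rw [inv_mul_eq_div]
    refine le_gauge_of_subset_closedBall (absorbent_ballPlus _) hr1.le ?_
    rintro _ ⟨b, hb, q, hq, rfl⟩
    have h1 := hr hq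
    rw [mem_closedBall_zero_iff] at h1 hb ⊢
    linarith [norm_add_le b q, le_abs_self r]
  upper' := by
    refine ⟨1, fun x => ?_⟩
    have h := gauge_mono (absorbent_nhds_zero (𝕜 := ℝ)
      (closedBall_mem_nhds (0 : C0) one_pos)) (closedBall_subset_ballPlus (t := smallVec)) x
    rw [gauge_closedBall zero_le_one, div_one] at h
    rw [one_mul]
    exact h

theorem norm_renormed_smoothNorm (x : Renormed smoothNorm) :
    ‖x‖ = gauge (ballPlus smallVec) (Renormed.toBase smoothNorm x) := rfl

theorem apply_le_of_norm_attained {x : Renormed smoothNorm} (f : StrongDual ℝ C0)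
    (hf : f (Renormed.toBase smoothNorm x) =
      ‖f.comp (Renormed.toBase smoothNorm : Renormed smoothNorm →L[ℝ] C0)‖) {y : C0}
    (hy : y ∈ ballPlus smallVec) : f y ≤ f (Renormed.toBase smoothNorm x) := by
  have h1 : ‖(Renormed.toBase smoothNorm).symm y‖ ≤ 1 := by
    rw [norm_renormed_smoothNorm, ContinuousLinearEquiv.apply_symm_apply]
    exact gauge_le_one_of_mem hy
  have h2 := (f.comp (Renormed.toBase smoothNorm : Renormed smoothNorm →L[ℝ] C0)).le_opNorm
    ((Renormed.toBase smoothNorm).symm y)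
  simp only [ContinuousLinearMap.comp_apply, ContinuousLinearEquiv.coe_coe,
    ContinuousLinearEquiv.apply_symm_apply] at h2
  rw [hf]
  exact (le_abs_self _).trans (h2.trans (mul_le_of_le_one_right (norm_nonneg _) h1))

theorem exists_decomp_of_norm_le_one {x : Renormed smoothNorm} (hx : ‖x‖ ≤ 1) :
    ∃ b : C0, ∃ a ∈ ellBall, ‖b‖ ≤ 1 ∧
      Renormed.toBase smoothNorm x = b + ∑' n, a n • smallVec n := by
  rw [norm_renormed_smoothNorm] at hx
  obtain ⟨b, hb, _, ⟨a, ha, rfl⟩, h⟩ := mem_ballPlus_of_gauge_le_one summable_norm_smallVec hx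
  exact ⟨b, a, ha, by simpa using hb, h.symm⟩

theorem apply_unitVec_of_apply_smallVec {f : StrongDual ℝ C0} {n : ℕ} :
    f (unitVec n) = 2 ^ n * f (smallVec n) := by
  rw [smallVec, map_smul, smul_eq_mul, ← mul_assoc, ← mul_pow]
  norm_num

theorem ext_unitVec {f g : StrongDual ℝ C0} (h : ∀ n, f (unitVec n) = g (unitVec n)) : f = g := by
  ext x
  refine ((hasSum_unitVec x).mapL f).unique (((hasSum_unitVec x).mapL g).congr_fun fun n => ?_)
  rw [map_smul, map_smul, h]

/-- All functionals supporting the ball at b + ∑ aₙ 2⁻ⁿ eₙ are multiples of one another, since their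
values at 2⁻ⁿ eₙ are proportional to aₙ. The value 1 at x fixes the factor. -/
theorem isSmoothNorm_smoothNorm : IsSmoothNorm (Renormed smoothNorm) := by
  intro x hx f g hf hg hfx hgx
  obtain ⟨b, a, ha, hb, hxb⟩ := exists_decomp_of_norm_le_one hx.le
  have key : ∀ f : StrongDual ℝ (Renormed smoothNorm), ‖f‖ = 1 → f x = 1 →
      ∃ f' : StrongDual ℝ C0, (∀ y, f' (Renormed.toBase smoothNorm y) = f y) ∧
        ∃ l : ℝ, ∀ n, f' (smallVec n) = l * a n := by
    intro f hf hfx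
    set f' : StrongDual ℝ C0 :=
      f.comp ((Renormed.toBase smoothNorm).symm : C0 →L[ℝ] Renormed smoothNorm) with hf'
    have h1 : ∀ y, f' (Renormed.toBase smoothNorm y) = f y := fun y => by simp [hf']
    have h2 : f'.comp (Renormed.toBase smoothNorm : Renormed smoothNorm →L[ℝ] C0) = f := by
      ext y; exact h1 y
    obtain ⟨-, l, -, hl⟩ := apply_eq_of_isMaxOn_ballPlus summable_norm_smallVec hb ha f'
      fun y hy => by
        rw [← hxb]
        exact apply_le_of_norm_attained f' (by rw [h1, hfx, h2, hf]) hy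
    exact ⟨f', h1, l, hl⟩
  obtain ⟨f', hf', l, hl⟩ := key f hf hfx
  obtain ⟨g', hg', m, hm⟩ := key g hg hgx
  have hl0 : l ≠ 0 := by
    rintro rfl
    have : f' = 0 := ext_unitVec fun n => by
      rw [apply_unitVec_of_apply_smallVec, hl]; simp
    rw [← hf', this] at hfx
    simp at hfx
  have h1 : g' = (m / l) • f' := ext_unitVec fun n => by
    rw [smul_apply, apply_unitVec_of_apply_smallVec,
      apply_unitVec_of_apply_smallVec, hl, hm, smul_eq_mul]
    field_simp
  have h2 : m / l = 1 := by
    have := hgx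
    rwa [← hg', h1, smul_apply, hf', hfx, smul_eq_mul, mul_one] at this
  rw [h2, one_smul] at h1
  ext y
  rw [← hf', ← hg', h1]

theorem exists_norm_eq_one_of_mem_normAttaining {E : Type*} [NormedAddCommGroup E]
    [NormedSpace ℝ E] {f : StrongDual ℝ E} (hf : f ∈ normAttaining E) :
    ∃ x : E, ‖x‖ = 1 ∧ f x = ‖f‖ := by
  obtain ⟨x, hx, h⟩ := hf
  rcases abs_eq (norm_nonneg f) |>.1 h with h | h
  · exact ⟨x, hx, h⟩
  · exact ⟨-x, by rwa [norm_neg], by rw [map_neg, h, neg_neg]⟩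

theorem zero_mem_normAttaining (E : Type*) [NormedAddCommGroup E] [NormedSpace ℝ E]
    [Nontrivial E] : (0 : StrongDual ℝ E) ∈ normAttaining E := by
  obtain ⟨x, hx⟩ := exists_norm_eq E zero_le_one
  exact ⟨x, hx, by simp⟩

instance : Nontrivial C0 := ⟨⟨unitVec 0, 0, fun h => by
  have := congrArg (fun x : C0 => x 0) h
  simp [unitVec_apply] at this⟩⟩

instance (p : EquivNorm C0) : Nontrivial (Renormed p) := inferInstanceAs (Nontrivial C0)

/-- A functional attains its supremum on a sum of two sets if and only if it does so on each of
them, and on the compact ellipsoid it always does. -/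
theorem normAttaining_smoothNorm_iff (f : StrongDual ℝ C0) :
    f.comp (Renormed.toBase smoothNorm : Renormed smoothNorm →L[ℝ] C0) ∈
      normAttaining (Renormed smoothNorm) ↔ f ∈ normAttaining C0 := by
  rcases eq_or_ne f 0 with rfl | hf0
  · rw [ContinuousLinearMap.zero_comp]
    exact iff_of_true (zero_mem_normAttaining _) (zero_mem_normAttaining _)
  have hfn : 0 < ‖f‖ := norm_dual_pos hf0
  constructor
  · intro h
    obtain ⟨x, hx, hfx⟩ := exists_norm_eq_one_of_mem_normAttaining h
    obtain ⟨b, a, ha, hb, hxb⟩ := exists_decomp_of_norm_le_one hx.le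
    obtain ⟨h1, -⟩ := apply_eq_of_isMaxOn_ballPlus summable_norm_smallVec hb ha f
      fun y hy => by
        rw [← hxb]
        exact apply_le_of_norm_attained f hfx hy
    refine ⟨b, le_antisymm hb ?_, by rw [h1, abs_of_pos hfn]⟩
    have h2 := f.le_opNorm b
    rw [h1, norm_norm] at h2
    by_contra! h3
    nlinarith
  · intro h
    obtain ⟨b, hb, hfb⟩ := exists_norm_eq_one_of_mem_normAttaining h
    obtain ⟨q, hq, hmax⟩ := (isCompact_ellHull summable_norm_smallVec).exists_isMaxOn
      ⟨_, Set.mem_image_of_mem _ zero_mem_ellBall⟩ f.continuous.continuousOn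
    have hxK : b + q ∈ ballPlus smallVec := ⟨b, by simp [hb], q, hq, rfl⟩
    have hle : ∀ y ∈ ballPlus smallVec, f y ≤ f (b + q) := by
      rintro _ ⟨c, hc, r, hr, rfl⟩
      rw [map_add, map_add]
      refine add_le_add ?_ (hmax hr)
      rw [hfb]
      exact (le_abs_self _).trans ((f.le_opNorm c).trans
        (mul_le_of_le_one_right hfn.le (by simpa using hc)))
    have hpos : 0 < f (b + q) := by
      refine lt_of_lt_of_le ?_ (hle b (closedBall_subset_ballPlus (by simp [hb])))
      rwa [hfb]
    set J := Renormed.toBase smoothNorm with hJ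
    set x := J.symm (b + q) with hxdef
    set f' := f.comp (J : Renormed smoothNorm →L[ℝ] C0) with hf'
    have hfx : f' x = f (b + q) := by simp [hf', hxdef]
    have hnorm : ‖f'‖ ≤ f' x := by
      have h1 : ∀ y : Renormed smoothNorm, ‖y‖ = 1 → f' y ≤ f' x := fun y hy => by
        rw [hfx]
        refine hle (J y) (mem_ballPlus_of_gauge_le_one summable_norm_smallVec ?_)
        rw [← norm_renormed_smoothNorm, hy]
      refine f'.opNorm_le_of_unit_norm (hfx ▸ hpos.le) fun y hy => abs_le.2 ⟨?_, h1 y hy⟩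
      have := h1 (-y) (by rwa [norm_neg])
      rw [map_neg] at this
      linarith
    have hx1 : ‖x‖ ≤ 1 := by
      rw [norm_renormed_smoothNorm, hxdef, ContinuousLinearEquiv.apply_symm_apply]
      exact gauge_le_one_of_mem hxK
    have h2 := f'.le_opNorm x
    rw [Real.norm_of_nonneg (hfx ▸ hpos.le)] at h2
    have hpos' : 0 < ‖f'‖ := by
      by_contra! h3
      nlinarith [norm_nonneg x]
    have hx2 : 1 ≤ ‖x‖ := by
      by_contra! h3
      nlinarith
    have hx3 := le_antisymm hx1 hx2
    refine ⟨x, hx3, ?_⟩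
    rw [abs_of_nonneg (hfx ▸ hpos.le)]
    refine le_antisymm ?_ hnorm
    rwa [hx3, mul_one] at h2

end SmoothNorm

/-! ### Operators on ℓ₁ whose range avoids finitely supported vectors -/

section SparseOperator

/-- The operator on `ℓ₁` with prescribed values, of summable norms, at the unit vectors. -/
theorem exists_clm_of_summable_norm {V : Type*} [NormedAddCommGroup V] [NormedSpace ℝ V]
    [CompleteSpace V] {ι : Type} [DecidableEq ι] (v : ι → V) (hv : Summable fun k => ‖v k‖) :
    ∃ T : Ell1 ι →L[ℝ] V, (∀ a, HasSum (fun k => a k • v k) (T a)) ∧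
      ∀ k, T (lp.single 1 k (1 : ℝ)) = v k := by
  have heval : ∀ (k : ι) (a : Ell1 ι), ‖a k‖ ≤ ‖a‖ := fun k a =>
    lp.norm_apply_le_norm one_ne_zero a k
  have hs : Summable fun k => (lp.evalCLM ℝ (fun _ : ι => ℝ) 1 k).smulRight (v k) := by
    refine Summable.of_norm_bounded hv fun k => ?_
    refine ContinuousLinearMap.opNorm_le_bound _ (norm_nonneg _) fun a => ?_
    rw [ContinuousLinearMap.smulRight_apply, norm_smul, mul_comm]
    exact mul_le_mul_of_nonneg_left (heval k a) (norm_nonneg _)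
  have h1 : ∀ a, HasSum (fun k => a k • v k)
      ((∑' k, (lp.evalCLM ℝ (fun _ : ι => ℝ) 1 k).smulRight (v k)) a) := fun a =>
    hs.hasSum.mapL (ContinuousLinearMap.apply ℝ V a)
  refine ⟨_, h1, fun k => ?_⟩
  refine (h1 _).unique ?_
  have h2 := hasSum_single (f := fun j => (lp.single (E := fun _ : ι => ℝ) 1 k (1 : ℝ)) j • v j) k
    fun j hj => by rw [lp.single_apply_ne _ _ _ hj, zero_smul]
  rwa [lp.single_apply_self, one_smul] at h2

variable {V : Type*} [NormedAddCommGroup V] [NormedSpace ℝ V]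

theorem separableSpace_of_hasSum {d : ℕ → V} {c : ℕ → StrongDual ℝ V}
    (hdc : ∀ f, HasSum (fun i => c i f • d i) f) : TopologicalSpace.SeparableSpace V := by
  have h1 : TopologicalSpace.IsSeparable (closure (Submodule.span ℝ (Set.range d) : Set V)) :=
    ((Set.countable_range d).isSeparable.span (R := ℝ)).closure
  rw [← TopologicalSpace.isSeparable_univ_iff]
  refine h1.mono fun f _ => ?_
  refine mem_closure_of_tendsto (hdc f) (Eventually.of_forall fun s => ?_)
  exact Submodule.sum_mem _ fun i _ => Submodule.smul_mem _ _ (Submodule.subset_span ⟨i, rfl⟩)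

variable (d : ℕ → V) (c : ℕ → StrongDual ℝ V)

/-- The coefficients of `sparseVec`. -/
noncomputable def sparseCoeff (l i : ℕ) : ℝ := if (Nat.unpair i).1 = l then (1 / 2) ^ i else 0

/-- A vector supported by the `l`-th set of a partition of `ℕ` into infinite sets. -/
noncomputable def sparseVec (l : ℕ) : V := ∑' i, sparseCoeff l i • d i

/-- A truncation of `D r`, where `n = (r, j)`, with a small infinitely supported perturbation. -/
noncomputable def perturbed (D : ℕ → V) (k : ℕ × ℕ) : V :=
  ∑ i ∈ Finset.range (k.1 + 1), c i (D (Nat.unpair k.1).1) • d i +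
    (1 / 2 : ℝ) ^ k.1 • sparseVec d (Nat.pair k.1 k.2)

theorem abs_sparseCoeff_le (l i : ℕ) : |sparseCoeff l i| ≤ (1 / 2) ^ i := by
  rw [sparseCoeff]
  split_ifs
  · rw [abs_of_nonneg (by positivity)]
  · rw [abs_zero]; positivity

variable {d c} {B : ℝ}

theorem norm_sparseCoeff_smul_le (hd : ∀ i, ‖d i‖ ≤ B) (l i : ℕ) :
    ‖sparseCoeff l i • d i‖ ≤ (1 / 2) ^ i * B := by
  rw [norm_smul]
  exact mul_le_mul (abs_sparseCoeff_le l i) (hd i) (norm_nonneg _) (by positivity)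

theorem summable_half_pow_mul (B : ℝ) : Summable fun i : ℕ => (1 / 2 : ℝ) ^ i * B :=
  summable_geometric_two.mul_right B

theorem norm_sparseVec_le (hd : ∀ i, ‖d i‖ ≤ B) (l : ℕ) : ‖sparseVec d l‖ ≤ 2 * B := by
  refine tsum_of_norm_bounded ?_ (norm_sparseCoeff_smul_le hd l)
  exact hasSum_geometric_two.mul_right B

theorem apply_sparseVec [CompleteSpace V] (hd : ∀ i, ‖d i‖ ≤ B)
    (hcd : ∀ i j, c i (d j) = if i = j then 1 else 0) (l i : ℕ) :
    c i (sparseVec d l) = sparseCoeff l i := by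
  have hs : Summable fun j => sparseCoeff l j • d j :=
    Summable.of_norm_bounded (summable_half_pow_mul B) (norm_sparseCoeff_smul_le hd l)
  rw [sparseVec, (c i).map_tsum hs, tsum_eq_single i]
  · simp [hcd]
  · intro j hj
    simp [hcd, hj.symm]

theorem apply_perturbed [CompleteSpace V] (hd : ∀ i, ‖d i‖ ≤ B)
    (hcd : ∀ i j, c i (d j) = if i = j then 1 else 0) (D : ℕ → V) (k : ℕ × ℕ) (i : ℕ) :
    c i (perturbed d c D k) = (if i ≤ k.1 then c i (D (Nat.unpair k.1).1) else 0) +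
      (1 / 2 : ℝ) ^ k.1 * sparseCoeff (Nat.pair k.1 k.2) i := by
  rw [perturbed, map_add, map_sum, map_smul, apply_sparseVec hd hcd, smul_eq_mul]
  congr 1
  simp [hcd]

theorem tendsto_perturbed (hd : ∀ i, ‖d i‖ ≤ B) (hdc : ∀ f, HasSum (fun i => c i f • d i) f)
    (D : ℕ → V) (r m : ℕ) :
    Tendsto (fun j => perturbed d c D (Nat.pair r j, m)) atTop (𝓝 (D r)) := by
  have hp : Tendsto (fun j => Nat.pair r j) atTop atTop :=
    tendsto_atTop_mono (fun j => Nat.right_le_pair r j) tendsto_id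
  have h1 : Tendsto (fun j => ∑ i ∈ Finset.range (Nat.pair r j + 1), c i (D r) • d i) atTop
      (𝓝 (D r)) :=
    (hdc (D r)).tendsto_sum_nat.comp ((tendsto_add_atTop_nat 1).comp hp)
  have h2 : Tendsto (fun j => (1 / 2 : ℝ) ^ Nat.pair r j * (2 * B)) atTop (𝓝 0) := by
    have := ((tendsto_pow_atTop_nhds_zero_of_lt_one (r := (1 / 2 : ℝ)) (by norm_num)
      (by norm_num)).comp hp).mul_const (2 * B)
    rwa [zero_mul] at this
  have h3 : Tendsto (fun j => (1 / 2 : ℝ) ^ Nat.pair r j • sparseVec d (Nat.pair (Nat.pair r j) m))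
      atTop (𝓝 0) := by
    refine squeeze_zero_norm (fun j => ?_) h2
    rw [norm_smul, Real.norm_of_nonneg (by positivity)]
    exact mul_le_mul_of_nonneg_left (norm_sparseVec_le hd _) (by positivity)
  have h4 := h1.add h3
  rw [add_zero] at h4
  simpa [perturbed] using h4

theorem summable_quarter_pow_pair : Summable fun k : ℕ × ℕ => (1 / 4 : ℝ) ^ Nat.pair k.1 k.2 :=
  (summable_geometric_of_lt_one (r := (1 / 4 : ℝ)) (by norm_num) (by norm_num)).comp_injective
    Nat.pairEquiv.injective

/-- An infinite combination of scaled perturbed truncations has infinite support. -/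
theorem eq_zero_of_tail_eq_zero [CompleteSpace V] (hd : ∀ i, ‖d i‖ ≤ B) (hc : ∀ i, ‖c i‖ ≤ B)
    (hcd : ∀ i j, c i (d j) = if i = j then 1 else 0) {D : ℕ → V} {e : ℕ × ℕ → ℝ}
    (he : ∀ k, 0 < e k)
    (heD : ∀ k, e k * ‖D (Nat.unpair k.1).1‖ ≤ (1 / 4) ^ Nat.pair k.1 k.2)
    {a : Ell1 (ℕ × ℕ)} {f : V} (ha : HasSum (fun k => a k • e k • perturbed d c D k) f) {N : ℕ}
    (hf : ∀ i, N ≤ i → c i f = 0) : a = 0 := by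
  have hB : 0 ≤ B := (norm_nonneg _).trans (hd 0)
  have hasum : Summable fun k => ‖a k‖ := by
    simpa using (lp.hasSum_norm (p := 1) (by simp) a).summable
  set A := ∑' k, ‖a k‖ with hA
  ext k
  -- At the coordinate i = ((k), j) only the k-th sparse vector is non-zero, contributing a multiple
  -- of 2⁻ⁱ. A truncation reaches i only if its index l has l.1 ≥ i, and then its factor e l makes
  -- it O(4⁻ⁱ). As the total vanishes, dividing by 2⁻ⁱ and letting j → ∞ yields a k = 0.
  have key : ∀ j, N ≤ j → |a k| * e k * (1 / 2) ^ k.1 ≤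
      (A * B) * (1 / 2) ^ (Nat.pair (Nat.pair k.1 k.2) j) := by
    intro j hj
    set i := Nat.pair (Nat.pair k.1 k.2) j with hi
    have hui : (Nat.unpair i).1 = Nat.pair k.1 k.2 := by rw [hi, Nat.unpair_pair]
    have h1 := ha.mapL (c i)
    rw [hf i (hj.trans (Nat.right_le_pair _ _))] at h1
    set F : ℕ × ℕ → ℝ := fun l => a l * (e l * if i ≤ l.1 then c i (D (Nat.unpair l.1).1) else 0)
      with hF
    have h2 : HasSum (fun l => a l * (e l * ((1 / 2 : ℝ) ^ l.1 * sparseCoeff (Nat.pair l.1 l.2) i)))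
        (a k * (e k * ((1 / 2 : ℝ) ^ k.1 * (1 / 2) ^ i))) := by
      have h3 := hasSum_single
        (f := fun l => a l * (e l * ((1 / 2 : ℝ) ^ l.1 * sparseCoeff (Nat.pair l.1 l.2) i))) k
        fun l hl => by
          have h4 : (Nat.unpair i).1 ≠ Nat.pair l.1 l.2 := by
            rw [hui]
            exact fun h => hl (Nat.pairEquiv.injective h.symm)
          simp [sparseCoeff, h4]
      simpa [sparseCoeff, hui] using h3
    have h3 : HasSum F (-(a k * (e k * ((1 / 2 : ℝ) ^ k.1 * (1 / 2) ^ i)))) := by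
      have h4 := h1.sub h2
      rw [zero_sub] at h4
      refine h4.congr_fun fun l => ?_
      rw [map_smul, map_smul, apply_perturbed hd hcd]
      simp only [hF, smul_eq_mul]
      ring
    have h4 : ∀ l, ‖F l‖ ≤ ‖a l‖ * (B * (1 / 4) ^ i) := by
      intro l
      rw [hF, norm_mul]
      refine mul_le_mul_of_nonneg_left ?_ (norm_nonneg _)
      split_ifs with hil
      · rw [norm_mul, Real.norm_of_nonneg (he l).le]
        have h5 := (c i).le_of_opNorm_le (hc i) (D (Nat.unpair l.1).1)
        calc e l * ‖c i (D (Nat.unpair l.1).1)‖ ≤ e l * (B * ‖D (Nat.unpair l.1).1‖) :=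
              mul_le_mul_of_nonneg_left h5 (he l).le
          _ = B * (e l * ‖D (Nat.unpair l.1).1‖) := by ring
          _ ≤ B * (1 / 4) ^ i := by
            refine mul_le_mul_of_nonneg_left ((heD l).trans ?_) hB
            exact pow_le_pow_of_le_one (by norm_num) (by norm_num)
              (hil.trans (Nat.left_le_pair _ _))
      · rw [mul_zero, norm_zero]
        exact mul_nonneg hB (by positivity)
    have h5 := tsum_of_norm_bounded (hasum.hasSum.mul_right (B * (1 / 4) ^ i)) h4
    have h8 : ‖e k * ((1 / 2 : ℝ) ^ k.1 * (1 / 2) ^ i)‖ = e k * ((1 / 2) ^ k.1 * (1 / 2) ^ i) :=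
      Real.norm_of_nonneg (mul_nonneg (he k).le (by positivity))
    rw [h3.tsum_eq, norm_neg, ← hA, norm_mul, h8, Real.norm_eq_abs] at h5
    have h6 : (1 / 4 : ℝ) ^ i = (1 / 2) ^ i * (1 / 2) ^ i := by rw [← mul_pow]; norm_num
    rw [h6] at h5
    have h7 : (0 : ℝ) < (1 / 2) ^ i := by positivity
    refine le_of_mul_le_mul_right ?_ h7
    linarith
  have hlim : Tendsto (fun j => (A * B) * (1 / 2 : ℝ) ^ (Nat.pair (Nat.pair k.1 k.2) j)) atTop
      (𝓝 0) := by
    have hp : Tendsto (fun j => Nat.pair (Nat.pair k.1 k.2) j) atTop atTop :=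
      tendsto_atTop_mono (fun j => Nat.right_le_pair _ j) tendsto_id
    have := ((tendsto_pow_atTop_nhds_zero_of_lt_one (r := (1 / 2 : ℝ)) (by norm_num)
      (by norm_num)).comp hp).const_mul (A * B)
    rwa [mul_zero] at this
  have h8 : |a k| * e k * (1 / 2) ^ k.1 ≤ 0 :=
    ge_of_tendsto hlim ((eventually_ge_atTop N).mono fun j hj => key j hj)
  have h9 : (0 : ℝ) < e k * (1 / 2) ^ k.1 := mul_pos (he k) (by positivity)
  rw [mul_assoc] at h8
  by_contra h
  exact absurd h8 (not_le.2 (mul_pos (abs_pos.2 h) h9))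

theorem mem_closure_range_normalize {ι : Type*} {w : ι → V} (hw : DenseRange w) {f : V}
    (hf : ‖f‖ = 1) : f ∈ closure (Set.range fun n => ‖w n‖⁻¹ • w n) := by
  have hf0 : f ≠ 0 := fun h => by simp [h] at hf
  have h1 : ContinuousAt (fun g : V => ‖g‖⁻¹ • g) f :=
    (continuousAt_id.norm.inv₀ (norm_ne_zero_iff.2 hf0)).smul continuousAt_id
  have h2 := mem_closure_image h1 (hw f)
  rw [hf, inv_one, one_smul, ← Set.range_comp] at h2
  exact h2

/-- In a space with a basis there is an operator of norm one from `ℓ₁(ℕ × ℕ)` whose range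
contains no non-zero vector of finite support, and with normalised images of the unit vectors
dense in the unit sphere. -/
theorem exists_operator_range_avoiding_finite_support [CompleteSpace V] (hd : ∀ i, ‖d i‖ ≤ B)
    (hc : ∀ i, ‖c i‖ ≤ B) (hcd : ∀ i j, c i (d j) = if i = j then 1 else 0)
    (hdc : ∀ f, HasSum (fun i => c i f • d i) f) :
    ∃ T : Ell1 (ℕ × ℕ) →L[ℝ] V, ‖T‖ = 1 ∧ (∀ a, (∃ N, ∀ i, N ≤ i → c i (T a) = 0) → a = 0) ∧
      ∀ m : ℕ, ∀ f : V, ‖f‖ = 1 → f ∈ closure (Set.range fun n : ℕ =>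
        ‖T (lp.single 1 (n, m) (1 : ℝ))‖⁻¹ • T (lp.single 1 (n, m) (1 : ℝ))) := by
  have := separableSpace_of_hasSum hdc
  set D := TopologicalSpace.denseSeq V with hD
  set w := perturbed d c D with hw
  -- The summand ‖w k‖ in the denominator makes the images of the unit vectors summable; the summand
  -- with D gives the decay of the truncations that `eq_zero_of_tail_eq_zero` needs.
  set e : ℕ × ℕ → ℝ := fun k =>
    (1 / 4) ^ Nat.pair k.1 k.2 / (1 + ‖w k‖ + ‖D (Nat.unpair k.1).1‖) with he
  have he0 : ∀ k, 0 < e k := fun k => by positivity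
  have hden : ∀ k, 0 < 1 + ‖w k‖ + ‖D (Nat.unpair k.1).1‖ := fun k => by positivity
  have hew : ∀ k, ‖e k • w k‖ ≤ (1 / 4) ^ Nat.pair k.1 k.2 := fun k => by
    rw [norm_smul, Real.norm_of_nonneg (he0 k).le, he, div_mul_eq_mul_div, div_le_iff₀ (hden k)]
    refine mul_le_mul_of_nonneg_left ?_ (by positivity)
    linarith [norm_nonneg (D (Nat.unpair k.1).1)]
  have heD : ∀ k, e k * ‖D (Nat.unpair k.1).1‖ ≤ (1 / 4) ^ Nat.pair k.1 k.2 := fun k => by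
    rw [he, div_mul_eq_mul_div, div_le_iff₀ (hden k)]
    refine mul_le_mul_of_nonneg_left ?_ (by positivity)
    linarith [norm_nonneg (w k)]
  obtain ⟨T, hT, hTs⟩ := exists_clm_of_summable_norm (fun k => e k • w k)
    (Summable.of_nonneg_of_le (fun _ => norm_nonneg _) hew summable_quarter_pow_pair)
  have hinj : ∀ a, (∃ N, ∀ i, N ≤ i → c i (T a) = 0) → a = 0 := fun a ⟨N, hN⟩ =>
    eq_zero_of_tail_eq_zero hd hc hcd he0 heD (hT a) hN
  have hT0 : T ≠ 0 := by
    rintro rfl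
    have h1 := hinj (lp.single 1 (0, 0) (1 : ℝ)) ⟨0, fun i _ => by simp⟩
    have h2 : ‖lp.single (E := fun _ : ℕ × ℕ => ℝ) 1 (0, 0) (1 : ℝ)‖ = 1 := by
      rw [lp.norm_single (by simp), norm_one]
    rw [h1, norm_zero] at h2
    exact zero_ne_one h2
  have hTn : 0 < ‖T‖ := norm_pos_iff.2 hT0
  have hdense : ∀ m, DenseRange fun n => w (n, m) := fun m => by
    have h1 : Set.range D ⊆ closure (Set.range fun n => w (n, m)) := by
      rintro _ ⟨r, rfl⟩
      exact mem_closure_of_tendsto (tendsto_perturbed hd hdc D r m)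
        (Eventually.of_forall fun j => ⟨_, rfl⟩)
    intro f
    exact closure_minimal h1 isClosed_closure (TopologicalSpace.denseRange_denseSeq V f)
  refine ⟨‖T‖⁻¹ • T, ?_, fun a ⟨N, hN⟩ => hinj a ⟨N, fun i hi => ?_⟩, fun m f hf => ?_⟩
  · rw [norm_smul, norm_inv, norm_norm, inv_mul_cancel₀ hTn.ne']
  · have := hN i hi
    rw [smul_apply, map_smul, smul_eq_mul] at this
    exact (mul_eq_zero.1 this).resolve_left (inv_ne_zero hTn.ne')
  · convert mem_closure_range_normalize (hdense m) hf using 4 with n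
    have h1 : 0 < ‖T‖⁻¹ * e (n, m) := mul_pos (inv_pos.2 hTn) (he0 _)
    have h2 : (‖T‖⁻¹ • T) (lp.single 1 (n, m) (1 : ℝ)) = (‖T‖⁻¹ * e (n, m)) • w (n, m) := by
      rw [smul_apply, hTs, smul_smul]
    rw [h2, norm_smul, Real.norm_of_nonneg h1.le, smul_smul, mul_inv, mul_right_comm,
      inv_mul_cancel₀ h1.ne', one_mul]

end SparseOperator

/-! ### Existence of the choices -/

section Existence

/-- The unit vectors of `(c₀, smoothNorm)`. -/
noncomputable def basisVec (n : ℕ) : Renormed smoothNorm :=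
  (Renormed.toBase smoothNorm).symm (unitVec n)

/-- The coordinate functionals of `(c₀, smoothNorm)`. -/
noncomputable def dualVec (n : ℕ) : StrongDual ℝ (Renormed smoothNorm) :=
  (coord n).comp (Renormed.toBase smoothNorm : Renormed smoothNorm →L[ℝ] C0)

theorem mem_normAttaining_renormed_iff {p : EquivNorm C0}
    (hp : ∀ f : StrongDual ℝ C0, f.comp (Renormed.toBase p : Renormed p →L[ℝ] C0) ∈
      normAttaining (Renormed p) ↔ f ∈ normAttaining C0)
    (f : StrongDual ℝ (Renormed p)) : f ∈ normAttaining (Renormed p) ↔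
      ∃ N, ∀ n, N ≤ n → f ((Renormed.toBase p).symm (unitVec n)) = 0 := by
  have h := hp (f.comp ((Renormed.toBase p).symm : C0 →L[ℝ] Renormed p))
  rw [mem_normAttaining_C0_iff] at h
  rw [← show (f.comp ((Renormed.toBase p).symm : C0 →L[ℝ] Renormed p)).comp
    (Renormed.toBase p : Renormed p →L[ℝ] C0) = f by ext; simp, h]
  simp

theorem exists_norm_dualVec_le : ∃ B, ∀ n, ‖dualVec n‖ ≤ B :=
  ⟨1 * ‖(Renormed.toBase smoothNorm : Renormed smoothNorm →L[ℝ] C0)‖, fun n =>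
    (ContinuousLinearMap.opNorm_comp_le _ _).trans
      (mul_le_mul_of_nonneg_right (norm_coord_le n) (norm_nonneg _))⟩

theorem exists_norm_basisVec_le : ∃ B, ∀ n, ‖basisVec n‖ ≤ B := by
  obtain ⟨C, hC⟩ := smoothNorm.upper'
  exact ⟨|C|, fun n => (hC (unitVec n)).trans ((mul_le_mul_of_nonneg_right (le_abs_self C)
    (norm_nonneg _)).trans (mul_le_of_le_one_right (abs_nonneg C) (norm_unitVec_le n)))⟩

theorem hasSum_basisVec (x : Renormed smoothNorm) : HasSum (fun n => dualVec n x • basisVec n) x := by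
  have h := (hasSum_unitVec (Renormed.toBase smoothNorm x)).mapL
    ((Renormed.toBase smoothNorm).symm : C0 →L[ℝ] Renormed smoothNorm)
  simp only [ContinuousLinearEquiv.coe_coe, ContinuousLinearEquiv.symm_apply_apply, map_smul] at h
  exact h

theorem hasSum_dualVec (f : StrongDual ℝ (Renormed smoothNorm)) :
    HasSum (fun n => f (basisVec n) • dualVec n) f := by
  obtain ⟨B, hB⟩ := exists_norm_dualVec_le
  exact hasSum_apply_smul_dual hasSum_basisVec hB f (summable_abs_apply_unitVec
    (f.comp ((Renormed.toBase smoothNorm).symm : C0 →L[ℝ] Renormed smoothNorm)))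

theorem dualVec_basisVec (i j : ℕ) : dualVec j (basisVec i) = if i = j then 1 else 0 := by
  rw [dualVec, basisVec, ContinuousLinearMap.comp_apply, ContinuousLinearEquiv.coe_coe,
    ContinuousLinearEquiv.apply_symm_apply, coord_apply, unitVec_apply]
  exact if_congr eq_comm rfl rfl

theorem norm_evaluation_le {E : Type*} [NormedAddCommGroup E] [NormedSpace ℝ E] (x : E) :
    ‖ContinuousLinearMap.apply ℝ ℝ x‖ ≤ ‖x‖ :=
  ContinuousLinearMap.opNorm_le_bound _ (norm_nonneg _) fun f => by
    rw [ContinuousLinearMap.apply_apply, mul_comm]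
    exact f.le_opNorm _

theorem exists_operator_dual_smoothNorm :
    ∃ T : Ell1 (ℕ × ℕ) →L[ℝ] StrongDual ℝ (Renormed smoothNorm), ‖T‖ = 1 ∧
      (∀ a, (∃ N, ∀ i, N ≤ i → T a (basisVec i) = 0) → a = 0) ∧
      ∀ m : ℕ, ∀ f : StrongDual ℝ (Renormed smoothNorm), ‖f‖ = 1 →
        f ∈ closure (Set.range fun n : ℕ =>
          ‖T (lp.single 1 (n, m) (1 : ℝ))‖⁻¹ • T (lp.single 1 (n, m) (1 : ℝ))) := by
  obtain ⟨B₁, hB₁⟩ := exists_norm_dualVec_le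
  obtain ⟨B₂, hB₂⟩ := exists_norm_basisVec_le
  exact exists_operator_range_avoiding_finite_support
    (V := StrongDual ℝ (Renormed smoothNorm)) (d := dualVec)
    (c := fun n => ContinuousLinearMap.apply ℝ ℝ (basisVec n)) (B := max B₁ B₂)
    (fun n => (hB₁ n).trans (le_max_left _ _))
    (fun n => (norm_evaluation_le _).trans ((hB₂ n).trans (le_max_right _ _)))
    dualVec_basisVec hasSum_dualVec

theorem linearIndependent_single (ι : Type) [DecidableEq ι] :
    LinearIndependent ℝ fun k : ι => (lp.single 1 k (1 : ℝ) : Ell1 ι) := by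
  rw [linearIndependent_iff']
  intro s g hg k hk
  have h := congrArg (lp.evalCLM ℝ (fun _ : ι => ℝ) 1 k) hg
  rw [map_sum, map_zero, Finset.sum_eq_single k] at h
  · rw [map_smul, smul_eq_mul] at h
    have h1 : lp.evalCLM ℝ (fun _ : ι => ℝ) 1 k (lp.single 1 k (1 : ℝ)) = 1 :=
      lp.single_apply_self 1 k 1
    rwa [h1, mul_one] at h
  · intro j _ hj
    rw [map_smul]
    have h1 : lp.evalCLM ℝ (fun _ : ι => ℝ) 1 k (lp.single 1 j (1 : ℝ)) = 0 :=
      lp.single_apply_ne 1 j 1 hj.symm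
    rw [h1, smul_zero]
  · exact fun h => absurd hk h

theorem not_finiteDimensional_ell1 (ι : Type) [Infinite ι] : ¬ FiniteDimensional ℝ (Ell1 ι) := by
  classical
  intro h
  exact not_finite_iff_infinite.2 ‹Infinite ι› (linearIndependent_single ι).finite

theorem dense_of_sphere_subset_closure {V : Type*} [NormedAddCommGroup V] [NormedSpace ℝ V]
    (Y : Submodule ℝ V) (h : ∀ f : V, ‖f‖ = 1 → f ∈ closure (Y : Set V)) : Dense (Y : Set V) := by
  intro f
  rcases eq_or_ne f 0 with rfl | hf
  · exact subset_closure Y.zero_mem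
  have h1 : ‖f‖⁻¹ • f ∈ Y.topologicalClosure := h (‖f‖⁻¹ • f) (by
    rw [norm_smul, norm_inv, norm_norm, inv_mul_cancel₀ (norm_ne_zero_iff.2 hf)])
  have h2 := Submodule.smul_mem _ ‖f‖ h1
  rwa [smul_inv_smul₀ (norm_ne_zero_iff.2 hf)] at h2

/-- With Y the range of T, a norm-attaining element of Y is some T a of finite support, so a = 0.
Density of Y follows from that of the normalised T e_{n,0} in the sphere. -/
theorem nonempty_choices : Nonempty Choices := by
  obtain ⟨T, hT1, hT2, hT3⟩ := exists_operator_dual_smoothNorm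
  have hinj : Function.Injective T := (injective_iff_map_eq_zero T).2 fun a ha =>
    hT2 a ⟨0, fun i _ => by rw [ha]; rfl⟩
  have := separableSpace_of_hasSum
    (c := fun n => ContinuousLinearMap.apply ℝ ℝ (basisVec n)) hasSum_dualVec
  set Y := LinearMap.range (T : Ell1 (ℕ × ℕ) →ₗ[ℝ] StrongDual ℝ (Renormed smoothNorm)) with hY
  have hYT : ∀ a, T a ∈ Y := fun a => ⟨a, rfl⟩
  refine ⟨{
    nrm := smoothNorm
    smooth := isSmoothNorm_smoothNorm
    na_iff := normAttaining_smoothNorm_iff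
    Y := Y
    Y_range := ⟨Ell1 (ℕ × ℕ), inferInstance, inferInstance, inferInstance,
      not_finiteDimensional_ell1 _, T, hinj, rfl⟩
    Y_separable := TopologicalSpace.IsSeparable.of_separableSpace _
    Y_dense := dense_of_sphere_subset_closure Y fun f hf => closure_mono ?_ (hT3 0 f hf)
    Y_na := ?_
    T := T
    T_injective := hinj
    T_norm := hT1
    T_mem := hYT
    T_dense := fun m f hf => hT3 m f hf.2 }⟩
  · rintro _ ⟨n, rfl⟩
    exact Y.smul_mem _ (hYT _)
  · refine Set.eq_singleton_iff_unique_mem.2 ⟨⟨zero_mem_normAttaining _, Y.zero_mem⟩, ?_⟩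
    rintro _ ⟨h1, a, rfl⟩
    have h2 := hT2 a ((mem_normAttaining_renormed_iff normAttaining_smoothNorm_iff _).1 h1)
    rw [h2, map_zero]

end Existence

/-! ### Supporting functionals of the norms |·|_Φ -/

section PhiNorm

/-- The multiples `Φ(n) eₙ` of the unit vectors of `ℓ₁`. -/
noncomputable def phiVec (Φ : ℕ → ℝ) (n : ℕ) : Ell1 ℕ := Φ n • lp.single 1 n (1 : ℝ)

theorem norm_single_one {ι : Type} [DecidableEq ι] (k : ι) :
    ‖(lp.single 1 k (1 : ℝ) : Ell1 ι)‖ = 1 := by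
  rw [lp.norm_single (by simp), norm_one]

theorem hasSum_single_one {ι : Type} [DecidableEq ι] (z : Ell1 ι) :
    HasSum (fun k => z k • (lp.single 1 k (1 : ℝ) : Ell1 ι)) z := by
  refine (lp.hasSum_single (by simp) z).congr_fun fun k => ?_
  rw [← lp.single_smul, smul_eq_mul, mul_one]

variable {Φ : ℕ → ℝ}

theorem summable_norm_phiVec (hΦ : Summable fun n => |Φ n|) : Summable fun n => ‖phiVec Φ n‖ := by
  refine hΦ.congr fun n => ?_
  rw [phiVec, norm_smul, norm_single_one, mul_one, Real.norm_eq_abs]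

theorem tsum_smul_phiVec_apply (hΦ : Summable fun n => |Φ n|) {a : ℕ → ℝ} (ha : a ∈ ellBall) (n : ℕ) :
    (∑' k, a k • phiVec Φ k : Ell1 ℕ) n = Φ n * a n := by
  have hs := summable_smul_of_mem_ellBall (summable_norm_phiVec hΦ) ha
  change lp.evalCLM ℝ (fun _ : ℕ => ℝ) 1 n (∑' k, a k • phiVec Φ k) = _
  rw [ContinuousLinearMap.map_tsum _ hs, tsum_eq_single n]
  · rw [phiVec, map_smul, map_smul]
    have h1 : lp.evalCLM ℝ (fun _ : ℕ => ℝ) 1 n (lp.single 1 n (1 : ℝ)) = 1 :=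
      lp.single_apply_self 1 n 1
    rw [h1]
    simp [mul_comm]
  · intro k hk
    rw [phiVec, map_smul, map_smul]
    have h1 : lp.evalCLM ℝ (fun _ : ℕ => ℝ) 1 n (lp.single 1 k (1 : ℝ)) = 0 :=
      lp.single_apply_ne 1 k 1 hk.symm
    rw [h1, smul_zero, smul_zero]

theorem phiBall_eq_ballPlus (hΦ : Summable fun n => |Φ n|) : phiBall Φ = ballPlus (phiVec Φ) := by
  rw [phiBall, ballPlus]
  congr 1
  ext x
  constructor
  · rintro ⟨a, ha, hx⟩
    have ha' := (mem_ellBall_iff a).2 ⟨a, ha, rfl⟩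
    refine ⟨a, ha', ?_⟩
    ext n
    rw [hx]
    exact tsum_smul_phiVec_apply hΦ ha' n
  · rintro ⟨_, ha, rfl⟩
    obtain ⟨a, han, rfl⟩ := (mem_ellBall_iff _).1 ha
    exact ⟨a, han, fun n => tsum_smul_phiVec_apply hΦ ha n⟩

theorem phiNorm_pos (hΦ : Summable fun n => |Φ n|) {z : Ell1 ℕ} (hz : z ≠ 0) : 0 < phiNorm Φ z := by
  change 0 < gauge (phiBall Φ) z
  rw [phiBall_eq_ballPlus hΦ]
  refine (gauge_pos (absorbent_ballPlus _) ?_).2 hz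
  exact (NormedSpace.isVonNBounded_iff ℝ).2
    (isBounded_closedBall.add (isCompact_ellHull (summable_norm_phiVec hΦ)).isBounded)

/-- A supporting functional of `phiNorm Φ` is constant in modulus at the coordinates which are not
small. -/
theorem exists_sign_of_supports_phiNorm (hΦ : Summable fun n => |Φ n|)
    (hpos : ∀ n, 0 < Φ n) {w : StrongDual ℝ (Ell1 ℕ)}
    (hw : ∀ z, w z ≤ phiNorm Φ z) {z : Ell1 ℕ} (hz : z ≠ 0) (hwz : w z = phiNorm Φ z) :
    ∃ s : ℝ, 0 < s ∧ ∃ C : ℝ, 0 ≤ C ∧ ∀ n, |z n| ≤ C * Φ n ^ 2 ∨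
      (w (lp.single 1 n (1 : ℝ)) = s ∧ 0 < z n ∨ w (lp.single 1 n (1 : ℝ)) = -s ∧ z n < 0) := by
  have ht := summable_norm_phiVec hΦ
  set r := phiNorm Φ z with hr
  have hr0 : 0 < r := phiNorm_pos hΦ hz
  have hgauge : ∀ y, gauge (ballPlus (phiVec Φ)) y = phiNorm Φ y := fun y => by
    rw [← phiBall_eq_ballPlus hΦ]; rfl
  have hx1 : gauge (ballPlus (phiVec Φ)) (r⁻¹ • z) ≤ 1 := by
    rw [hgauge, map_smul_eq_mul, ← hr, Real.norm_of_nonneg (inv_pos.2 hr0).le,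
      inv_mul_cancel₀ hr0.ne']
  obtain ⟨b, hb, _, ⟨a, ha, rfl⟩, hx⟩ := mem_ballPlus_of_gauge_le_one ht hx1
  have hbn : ‖b‖ ≤ 1 := by simpa using hb
  have hwx : w (r⁻¹ • z) = 1 := by
    rw [map_smul, hwz, smul_eq_mul, inv_mul_cancel₀ hr0.ne']
  -- The normalised z is b + Φ·a, and w is maximal on the ball at b and on the ellipsoid at Φ·a.
  obtain ⟨hwb, l, hl0, hl⟩ := apply_eq_of_isMaxOn_ballPlus ht hbn ha w fun y hy => by
    have h1 : b + ∑' n, a n • phiVec Φ n = r⁻¹ • z := hx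
    rw [h1, hwx]
    exact (hw y).trans ((hgauge y).symm.le.trans (gauge_le_one_of_mem hy))
  have hw0 : w ≠ 0 := by
    rintro rfl
    simp at hwx
  have hs : 0 < ‖w‖ := norm_pos_iff.2 hw0
  have hl' : ∀ n, Φ n * w (lp.single 1 n (1 : ℝ)) = l * a n := fun n => by
    rw [← hl n, phiVec, map_smul, smul_eq_mul]
  have hlpos : 0 < l := by
    refine lt_of_le_of_ne hl0 fun h => hw0 ?_
    ext y
    refine ((hasSum_single_one y).mapL w).unique ?_
    refine (hasSum_zero).congr_fun fun n => ?_
    have h1 := hl' n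
    rw [← h, zero_mul] at h1
    rw [map_smul, (mul_eq_zero.1 h1).resolve_left (hpos n).ne', smul_zero]
  -- The differences of the two sides are non-negative and sum to ‖w‖‖b‖ - ‖w‖ ≤ 0, so each of them
  -- vanishes.
  have hterm : ∀ n, b n * w (lp.single 1 n (1 : ℝ)) = ‖w‖ * |b n| := by
    intro n
    have h1 : HasSum (fun n => |b n|) ‖b‖ := by
      simpa using lp.hasSum_norm (p := 1) (by simp) b
    have h2 := (h1.mul_left ‖w‖).sub ((hasSum_single_one b).mapL w)
    rw [hwb] at h2
    simp only [map_smul, smul_eq_mul] at h2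
    have h3 : ∀ k, b k * w (lp.single 1 k (1 : ℝ)) ≤ ‖w‖ * |b k| := fun k => by
      have h4 := w.le_opNorm (lp.single 1 k (1 : ℝ))
      rw [norm_single_one, mul_one] at h4
      refine (le_abs_self _).trans ?_
      rw [abs_mul, mul_comm]
      exact mul_le_mul_of_nonneg_right h4 (abs_nonneg _)
    have h5 := le_hasSum h2 n fun k _ => sub_nonneg.2 (h3 k)
    have h6 : ‖w‖ * ‖b‖ ≤ ‖w‖ := mul_le_of_le_one_right hs.le hbn
    linarith [h3 n]
  have hxn : ∀ n, z n = r * (b n + Φ n * a n) := fun n => by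
    have h1 : z = r • (b + ∑' n, a n • phiVec Φ n) := by
      have h2 : b + ∑' n, a n • phiVec Φ n = r⁻¹ • z := hx
      rw [h2, smul_inv_smul₀ hr0.ne']
    have h3 : z n = r * (b n + (∑' n, a n • phiVec Φ n : Ell1 ℕ) n) := by
      conv_lhs => rw [h1]
      rw [lp.coeFn_smul, lp.coeFn_add]
      rfl
    rw [h3, tsum_smul_phiVec_apply hΦ ha]
  have han : ∀ n, a n = Φ n * w (lp.single 1 n (1 : ℝ)) / l := fun n => by
    rw [hl', mul_div_cancel_left₀ _ hlpos.ne']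
  refine ⟨‖w‖, hs, r * ‖w‖ / l, by positivity, fun n => ?_⟩
  -- If b n ≠ 0, then w(eₙ) = ±‖w‖ with the sign of b n, and Φ(n)a(n) = Φ(n)² w(eₙ)/l does not have
  -- the opposite sign, so z n has this sign too. If b n = 0, only the ellipsoid term is left, and
  -- it is quadratic in Φ(n).
  rcases lt_trichotomy (b n) 0 with hbn0 | hbn0 | hbn0
  · right; right
    have h1 : w (lp.single 1 n (1 : ℝ)) = -‖w‖ := by
      have := hterm n
      rw [abs_of_neg hbn0] at this
      exact mul_left_cancel₀ hbn0.ne (by linarith)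
    refine ⟨h1, ?_⟩
    have h2 : Φ n * a n ≤ 0 := by
      rw [han, h1]
      have : 0 ≤ Φ n * (Φ n * ‖w‖ / l) := by have := hpos n; positivity
      have h3 : Φ n * (Φ n * -‖w‖ / l) = -(Φ n * (Φ n * ‖w‖ / l)) := by ring
      linarith
    rw [hxn]
    exact mul_neg_of_pos_of_neg hr0 (by linarith)
  · left
    have h4 := w.le_opNorm (lp.single 1 n (1 : ℝ))
    rw [norm_single_one, mul_one] at h4
    rw [hxn, hbn0, zero_add, han, abs_mul, abs_mul, abs_div, abs_mul, abs_of_pos hr0,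
      abs_of_pos (hpos n), abs_of_pos hlpos]
    calc r * (Φ n * (Φ n * |w (lp.single 1 n (1 : ℝ))| / l))
        ≤ r * (Φ n * (Φ n * ‖w‖ / l)) := by
          have := hpos n
          gcongr
          exact h4
      _ = r * ‖w‖ / l * Φ n ^ 2 := by ring
  · right; left
    have h1 : w (lp.single 1 n (1 : ℝ)) = ‖w‖ := by
      have := hterm n
      rw [abs_of_pos hbn0] at this
      exact mul_left_cancel₀ hbn0.ne' (by linarith)
    refine ⟨h1, ?_⟩
    have h2 : 0 ≤ Φ n * a n := by
      rw [han, h1]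
      have := hpos n
      positivity
    rw [hxn]
    exact mul_pos hr0 (by linarith)

end PhiNorm

/-! ### Density of the v*_{n,m} and splitting of supporting functionals -/

namespace Choices

variable (D : Choices)

theorem linearIndependent_v (m : ℕ) : LinearIndependent ℝ fun n => D.v n m := by
  have h1 := (linearIndependent_single (ℕ × ℕ)).map'
    (D.T : Ell1 (ℕ × ℕ) →ₗ[ℝ] StrongDual ℝ (Renormed D.nrm))
    (LinearMap.ker_eq_bot_of_injective D.T_injective)
  exact h1.comp (fun n => (n, m)) fun a b h => (Prod.ext_iff.1 h).1

theorem v_ne_zero (n m : ℕ) : D.v n m ≠ 0 := (D.linearIndependent_v m).ne_zero n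

/-- The functionals `v*_{n,m}`, `n ≥ N`, meet every non-empty open cone. -/
theorem exists_v_mem {U : Set (StrongDual ℝ (Renormed D.nrm))} (hU : IsOpen U)
    (hne : U.Nonempty) (hcone : ∀ g ∈ U, ∀ t : ℝ, 0 < t → t • g ∈ U) (m N : ℕ) :
    ∃ n, N ≤ n ∧ D.v n m ∈ U := by
  -- A proper finite-dimensional subspace is closed with empty interior, so `U \ W` is a non-empty
  -- open cone; any v*_{n,m} in it has n ≥ N.
  set W := Submodule.span ℝ ((fun n => D.v n m) '' Set.Iio N) with hW
  have : FiniteDimensional ℝ W :=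
    FiniteDimensional.span_of_finite ℝ ((Set.finite_Iio N).image _)
  have hWc : IsClosed (W : Set (StrongDual ℝ (Renormed D.nrm))) :=
    Submodule.closed_of_finiteDimensional W
  have hN : D.v N m ∉ W := (D.linearIndependent_v m).notMem_span_image (by simp)
  have hUW : (U \ W).Nonempty := by
    by_contra h
    rw [Set.not_nonempty_iff_eq_empty, Set.sdiff_eq_empty] at h
    have h1 := W.eq_top_of_nonempty_interior' (hne.mono (hU.subset_interior_iff.2 h))
    exact hN (h1 ▸ Submodule.mem_top)
  have hop : IsOpen (U \ W) := hU.sdiff hWc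
  obtain ⟨g, ⟨hgU, hgW⟩, hgY⟩ := D.Y_dense.inter_open_nonempty _ hop hUW
  have hg0 : g ≠ 0 := by
    rintro rfl
    exact hgW W.zero_mem
  have hgn : 0 < ‖g‖ := norm_pos_iff.2 hg0
  have h1 := D.T_dense m (show ‖g‖⁻¹ • g ∈ _ from ⟨D.Y.smul_mem _ hgY, by
    rw [norm_smul, norm_inv, norm_norm, inv_mul_cancel₀ hgn.ne']⟩)
  have h2 : ‖g‖⁻¹ • g ∈ U \ W := ⟨hcone g hgU _ (inv_pos.2 hgn), fun h => hgW (by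
    have := W.smul_mem ‖g‖ h
    rwa [smul_inv_smul₀ hgn.ne'] at this)⟩
  obtain ⟨_, ⟨hvU, hvW⟩, n, rfl⟩ := mem_closure_iff.1 h1 _ hop h2
  have hv : 0 < ‖D.v n m‖ := norm_pos_iff.2 (D.v_ne_zero n m)
  refine ⟨n, ?_, ?_⟩
  · by_contra! hn
    exact hvW (W.smul_mem _ (Submodule.subset_span ⟨n, hn, rfl⟩))
  · have := hcone _ hvU ‖D.v n m‖ hv
    change ‖D.v n m‖ • ‖D.v n m‖⁻¹ • D.v n m ∈ U at this
    rwa [smul_inv_smul₀ hv.ne'] at this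

theorem Phi_pos (m n : ℕ) : 0 < D.Φ m n := by
  have := norm_pos_iff.2 (D.v_ne_zero n m)
  unfold Choices.Φ
  positivity

theorem summable_abs_Phi (m : ℕ) : Summable fun n => |D.Φ m n| := by
  refine Summable.of_nonneg_of_le (fun _ => abs_nonneg _) (fun n => ?_) summable_geometric_two
  rw [abs_of_pos (D.Phi_pos m n), Choices.Φ]
  have h1 : (1 : ℝ) / 2 ^ (m + 1) ≤ 1 := by
    rw [div_le_one (by positivity)]
    exact one_le_pow₀ one_le_two
  have h2 : (1 : ℝ) / 2 ^ (n + 1) ≤ (1 / 2) ^ n := by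
    rw [← one_div_pow]
    exact pow_le_pow_of_le_one (by norm_num) (by norm_num) (Nat.le_succ n)
  calc _ ≤ 1 * (1 / 2 : ℝ) ^ n * 1 := by
        gcongr
        exact D.norm_v_le n m
    _ = _ := by ring

theorem R_apply (m : ℕ) (y : Renormed D.nrm) (n : ℕ) : D.R m y n = D.Rcoord m y n := rfl

/-- The functionals that do not vanish at y form a non-empty open cone, which therefore contains
some v*_{n,m}. -/
theorem R_ne_zero (m : ℕ) {y : Renormed D.nrm} (hy : y ≠ 0) : D.R m y ≠ 0 := by
  intro h
  obtain ⟨g, hg⟩ := SeparatingDual.exists_ne_zero (R := ℝ) hy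
  obtain ⟨n, -, hn⟩ := D.exists_v_mem (U := {g | g y ≠ 0})
    (isOpen_ne_fun (ContinuousLinearMap.apply ℝ ℝ y).continuous continuous_const) ⟨g, hg⟩
    (fun g hg t ht => by
      change t * g y ≠ 0
      exact mul_ne_zero ht.ne' hg) m 0
  have h1 : D.Rcoord m y n = 0 := by
    rw [← R_apply, h]; rfl
  rw [Choices.Rcoord] at h1
  have h2 : ((m : ℝ) + 1) / 2 ^ (m + 1) * (1 / 2 ^ (n + 1)) ≠ 0 := by positivity
  exact hn ((mul_eq_zero.1 h1).resolve_left h2)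

/-- The operator `y ↦ (R_m y)_m` into the `ℓ₁`-sum. -/
noncomputable def Rsum : Renormed D.nrm →ₗ[ℝ] lp (fun _ : ℕ => Ell1 ℕ) 1 where
  toFun y := ⟨fun m => D.R m y, memℓp_gen (by
    simpa using Summable.of_nonneg_of_le (fun _ => norm_nonneg _) (fun m => D.norm_R_le m y)
      (summable_weights.mul_right _))⟩
  map_add' x y := by
    ext1; funext m
    exact map_add (D.R m) x y
  map_smul' c x := by
    ext1; funext m
    exact map_smul (D.R m) c x

theorem summable_phiNorm (Z : lp (fun _ : ℕ => Ell1 ℕ) 1) :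
    Summable fun m => phiNorm (D.Φ m) (Z m) :=
  Summable.of_nonneg_of_le (fun _ => apply_nonneg _ _) (fun m => phiNorm_le (D.Φ m) (Z m)) (by
    simpa using (lp.hasSum_norm (p := 1) (by simp) Z).summable)

theorem tsum_phiNorm_le (Z : lp (fun _ : ℕ => Ell1 ℕ) 1) :
    ∑' m, phiNorm (D.Φ m) (Z m) ≤ ‖Z‖ := by
  have h1 : HasSum (fun m => ‖Z m‖) ‖Z‖ := by simpa using lp.hasSum_norm (p := 1) (by simp) Z
  exact h1.tsum_eq ▸ (D.summable_phiNorm Z).tsum_le_tsum (fun m => phiNorm_le (D.Φ m) (Z m))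
    h1.summable

/-- A supporting functional of `‖·‖ + ‖R ·‖_W` splits along the two summands. -/
theorem exists_decomp_of_supports {F : Renormed D.nrm →ₗ[ℝ] ℝ} (hF : ∀ y, F y ≤ ‖y‖ + D.normR y)
    {y₀ : Renormed D.nrm} (hF₀ : F y₀ = ‖y₀‖ + D.normR y₀) :
    ∃ u : StrongDual ℝ (Renormed D.nrm), ∃ w : ℕ → StrongDual ℝ (Ell1 ℕ),
      (∀ y, u y ≤ ‖y‖) ∧ u y₀ = ‖y₀‖ ∧ (∀ m z, w m z ≤ phiNorm (D.Φ m) z) ∧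
      (∀ m, w m (D.R m y₀) = phiNorm (D.Φ m) (D.R m y₀)) ∧
      ∀ y, HasSum (fun m => w m (D.R m y)) (F y - u y) := by
  set L := lp (fun _ : ℕ => Ell1 ℕ) 1
  -- F is regarded as a functional on the graph of y ↦ (R_m y)_m and extended to the whole product
  -- under the sum norm; the extension splits along the two factors.
  obtain ⟨g, hg1, hg2⟩ := exists_extension_of_le_sublinear
    (⟨LinearMap.graph D.Rsum, F ∘ₗ LinearMap.fst ℝ _ L ∘ₗ Submodule.subtype _⟩ :
      (Renormed D.nrm × L) →ₗ.[ℝ] ℝ)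
    (fun q => ‖q.1‖ + ∑' m, phiNorm (D.Φ m) (q.2 m))
    (fun c hc q => by
      have h1 : ∀ m, phiNorm (D.Φ m) ((c • q).2 m) = c * phiNorm (D.Φ m) (q.2 m) := fun m => by
        rw [Prod.smul_snd, lp.coeFn_smul, Pi.smul_apply, map_smul_eq_mul, Real.norm_of_nonneg hc.le]
      simp only [h1]
      rw [tsum_mul_left, Prod.smul_fst, norm_smul, Real.norm_of_nonneg hc.le, mul_add])
    (fun q r => by
      have h1 := (D.summable_phiNorm (q.2 + r.2)).tsum_le_tsum
        (fun m => map_add_le_add (phiNorm (D.Φ m)) (q.2 m) (r.2 m))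
        ((D.summable_phiNorm q.2).add (D.summable_phiNorm r.2))
      rw [(D.summable_phiNorm q.2).tsum_add (D.summable_phiNorm r.2)] at h1
      have h2 := norm_add_le q.1 r.1
      change ‖q.1 + r.1‖ + ∑' m, phiNorm (D.Φ m) ((q.2 + r.2 : L) m) ≤ _
      have h3 : ∑' m, phiNorm (D.Φ m) ((q.2 + r.2 : L) m) ≤
        ∑' m, phiNorm (D.Φ m) (q.2 m) + ∑' m, phiNorm (D.Φ m) (r.2 m) := h1
      linarith)
    (fun q => by
      obtain ⟨⟨y, Z⟩, hq⟩ := q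
      have hZ : Z = D.Rsum y := (LinearMap.mem_graph_iff _ _).1 hq
      subst hZ
      exact hF y)
  have hgF : ∀ y, g (y, D.Rsum y) = F y := fun y => hg1 ⟨(y, D.Rsum y), rfl⟩
  have hu : ∀ y, g (y, 0) ≤ ‖y‖ := fun y => by
    have h1 := hg2 (y, 0)
    simpa using h1
  have hW : ∀ Z : L, g (0, Z) ≤ ∑' m, phiNorm (D.Φ m) (Z m) := fun Z => by
    have h1 := hg2 (0, Z)
    simpa using h1
  set u : StrongDual ℝ (Renormed D.nrm) := LinearMap.mkContinuous (g ∘ₗ LinearMap.inl ℝ _ L) 1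
    (fun y => by
      rw [one_mul]
      refine abs_le.2 ⟨?_, hu y⟩
      have h1 := hu (-y)
      rw [norm_neg] at h1
      have h2 : g (-y, 0) = -g (y, 0) := by rw [← map_neg]; simp
      change -‖y‖ ≤ g (y, 0)
      linarith) with hudef
  set W : L →L[ℝ] ℝ := LinearMap.mkContinuous (g ∘ₗ LinearMap.inr ℝ (Renormed D.nrm) L) 1
    (fun Z => by
      rw [one_mul]
      refine abs_le.2 ⟨?_, (hW Z).trans (D.tsum_phiNorm_le Z)⟩
      have h1 := (hW (-Z)).trans (D.tsum_phiNorm_le (-Z))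
      rw [norm_neg] at h1
      have h2 : g (0, -Z) = -g (0, Z) := by rw [← map_neg]; simp
      change -‖Z‖ ≤ g (0, Z)
      linarith) with hWdef
  have hsplit : ∀ y, F y = u y + W (D.Rsum y) := fun y => by
    rw [← hgF]
    change _ = g (y, 0) + g (0, D.Rsum y)
    rw [← map_add]
    simp
  set w : ℕ → StrongDual ℝ (Ell1 ℕ) := fun m =>
    W.comp (lp.singleContinuousLinearMap ℝ (fun _ : ℕ => Ell1 ℕ) 1 m) with hw
  have hwle : ∀ m z, w m z ≤ phiNorm (D.Φ m) z := fun m z => by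
    refine (hW (lp.single 1 m z)).trans (le_of_eq ?_)
    rw [tsum_eq_single m]
    · rw [lp.single_apply_self]
    · intro k hk
      rw [lp.single_apply_ne _ _ _ hk, map_zero]
  have hsum : ∀ y, HasSum (fun m => w m (D.R m y)) (F y - u y) := fun y => by
    have h1 := (lp.hasSum_single (by simp) (D.Rsum y)).mapL W
    rw [hsplit, add_sub_cancel_left]
    exact h1
  have h1 := hsum y₀
  have h2 : HasSum (fun m => phiNorm (D.Φ m) (D.R m y₀)) (D.normR y₀) :=
    (D.summable_phiNorm_R y₀).hasSum
  -- Every piece is bounded by its own norm, and the bounds add up to the value F y₀; hence each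
  -- bound is an equality.
  have h3 := hasSum_le (fun m => hwle m (D.R m y₀)) h1 h2
  have hu0 : u y₀ = ‖y₀‖ := le_antisymm (hu y₀) (by linarith)
  refine ⟨u, w, hu, hu0, hwle, fun m => ?_, hsum⟩
  have h4 := le_hasSum (h2.sub h1) m fun k _ => sub_nonneg.2 (hwle k (D.R k y₀))
  exact le_antisymm (hwle m _) (by linarith)

end Choices

theorem _root_.HasSum.prod_swap {α β M : Type*} [AddCommMonoid M] [TopologicalSpace M]
    {f : α × β → M} {a : M} (h : HasSum f a) : HasSum (fun k : β × α => f (k.2, k.1)) a :=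
  (Equiv.hasSum_iff (f := f) (Equiv.prodComm β α)).2 h

/-! ### Separation of points and norm attainment -/

section Functionals

variable {E : Type*} [NormedAddCommGroup E] [NormedSpace ℝ E]

theorem exists_apply_eq_zero_apply_ne_zero {x y : E} (hx : x ≠ 0) (hxy : ∀ c : ℝ, y ≠ c • x) :
    ∃ h : StrongDual ℝ E, h x = 0 ∧ h y ≠ 0 := by
  obtain ⟨f, hf⟩ := SeparatingDual.exists_eq_one (R := ℝ) hx
  obtain ⟨k, hk⟩ := SeparatingDual.exists_eq_one (R := ℝ) (sub_ne_zero.2 (hxy (f y)))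
  refine ⟨k - k x • f, by simp [hf], ?_⟩
  rw [map_sub, map_smul, smul_eq_mul] at hk
  rw [sub_apply, smul_apply, smul_eq_mul, mul_comm, hk]
  exact one_ne_zero

theorem exists_apply_eq_zero_apply_ne_zero₂ {x y z : E} (hx : x ≠ 0) (hy : ∀ c : ℝ, y ≠ c • x)
    (hz : ∀ c : ℝ, z ≠ c • x) : ∃ h : StrongDual ℝ E, h x = 0 ∧ h y ≠ 0 ∧ h z ≠ 0 := by
  obtain ⟨f, hfx, hfy⟩ := exists_apply_eq_zero_apply_ne_zero hx hy
  obtain ⟨g, hgx, hgz⟩ := exists_apply_eq_zero_apply_ne_zero hx hz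
  by_cases hfz : f z = 0
  · by_cases hgy : g y = 0
    · exact ⟨f + g, by simp [hfx, hgx], by simpa [hgy] using hfy, by simpa [hfz] using hgz⟩
    · exact ⟨g, hgx, hgy, hgz⟩
  · exact ⟨f, hfx, hfy, hfz⟩

theorem hasSum_apply_dual {ι : Type*} {c : ι → ℝ} {f : ι → StrongDual ℝ E} {g : StrongDual ℝ E}
    (h : HasSum (fun k => c k • f k) g) (y : E) : HasSum (fun k => c k * f k y) (g y) :=
  h.mapL (ContinuousLinearMap.apply ℝ ℝ y)

theorem mem_normAttaining_of_le {u : StrongDual ℝ E} (hu : ∀ y, u y ≤ ‖y‖) {x : E} (hx : x ≠ 0)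
    (hux : u x = ‖x‖) : u ∈ normAttaining E := by
  have hxn : 0 < ‖x‖ := norm_pos_iff.2 hx
  have h1 : ‖u‖ ≤ 1 := u.opNorm_le_bound zero_le_one fun y => by
    rw [one_mul]
    refine abs_le.2 ⟨?_, hu y⟩
    have h := hu (-y)
    rw [norm_neg, map_neg] at h
    linarith
  have h2 : ‖(‖x‖⁻¹ • x)‖ = 1 := by rw [norm_smul, norm_inv, norm_norm, inv_mul_cancel₀ hxn.ne']
  have h3 : u (‖x‖⁻¹ • x) = 1 := by rw [map_smul, hux, smul_eq_mul, inv_mul_cancel₀ hxn.ne']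
  refine ⟨_, h2, ?_⟩
  have h4 := u.le_opNorm (‖x‖⁻¹ • x)
  rw [h2, h3, norm_one, mul_one] at h4
  rw [h3, abs_one]
  exact le_antisymm h4 h1

end Functionals

/-! ### Linear relations between supporting functionals -/

namespace Choices

variable (D : Choices)

/-- Norm-attaining functionals are those of finite support, a class closed under linear
combinations. -/
theorem sum_mem_normAttaining {ι : Type*} [Fintype ι] (a : ι → ℝ)
    {u : ι → StrongDual ℝ (Renormed D.nrm)} (hu : ∀ i, u i ∈ normAttaining (Renormed D.nrm)) :
    ∑ i, a i • u i ∈ normAttaining (Renormed D.nrm) := by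
  have h1 := fun i => (mem_normAttaining_renormed_iff D.na_iff (u i)).1 (hu i)
  choose N hN using h1
  refine (mem_normAttaining_renormed_iff D.na_iff _).2 ⟨∑ i, N i, fun n hn => ?_⟩
  rw [sum_apply]
  refine Finset.sum_eq_zero fun i hi => ?_
  rw [smul_apply, hN i n ((Finset.single_le_sum (fun _ _ => Nat.zero_le _) hi).trans hn), smul_zero]

theorem abs_apply_single_le {Φ : ℕ → ℝ} {w : StrongDual ℝ (Ell1 ℕ)} (hw : ∀ z, w z ≤ phiNorm Φ z)
    (n : ℕ) : |w (lp.single 1 n (1 : ℝ))| ≤ 1 := by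
  have h1 := fun z => (hw z).trans (phiNorm_le _ _)
  refine abs_le.2 ⟨?_, ?_⟩
  · have h2 := h1 (-lp.single 1 n (1 : ℝ))
    rw [norm_neg, norm_single_one, map_neg] at h2
    linarith
  · have h2 := h1 (lp.single 1 n (1 : ℝ))
    rwa [norm_single_one] at h2

/-- The factors of `v*_{n,m}` in the operators `R_m`. -/
noncomputable def weight (k : ℕ × ℕ) : ℝ :=
  ((k.2 : ℝ) + 1) / 2 ^ (k.2 + 1) * (1 / 2 ^ (k.1 + 1))

theorem weight_nonneg (k : ℕ × ℕ) : 0 ≤ weight k := by unfold weight; positivity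

theorem weight_zero (n : ℕ) : weight (n, 0) = 1 / 4 * (1 / 2) ^ n := by
  simp only [weight]
  rw [one_div_pow, pow_succ (2 : ℝ) n]
  norm_num
  ring

theorem summable_weight : Summable weight := by
  have h1 : Summable fun n : ℕ => (1 : ℝ) / 2 ^ (n + 1) := by
    have := (summable_nat_add_iff (f := fun n : ℕ => (1 / 2 : ℝ) ^ n) 1).2 summable_geometric_two
    refine this.congr fun n => ?_
    rw [one_div_pow]
  have h2 := h1.mul_of_nonneg summable_weights (fun n => by positivity) (fun m => by positivity)
  refine h2.congr fun k => ?_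
  rw [weight, mul_comm]

theorem exists_ell1_weight_mul {w : ℕ → StrongDual ℝ (Ell1 ℕ)}
    (hw : ∀ m n, |w m (lp.single 1 n (1 : ℝ))| ≤ 1) :
    ∃ b : Ell1 (ℕ × ℕ), ∀ k, b k = weight k * w k.2 (lp.single 1 k.1 (1 : ℝ)) := by
  refine ⟨⟨fun k => weight k * w k.2 (lp.single 1 k.1 (1 : ℝ)), memℓp_gen ?_⟩, fun _ => rfl⟩
  simp only [ENNReal.toReal_one, Real.rpow_one]
  refine Summable.of_nonneg_of_le (fun _ => norm_nonneg _) (fun k => ?_) summable_weight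
  rw [norm_mul, Real.norm_of_nonneg (weight_nonneg k)]
  exact mul_le_of_le_one_right (weight_nonneg k) (hw _ _)

theorem hasSum_apply_R {w : ℕ → StrongDual ℝ (Ell1 ℕ)} {b : Ell1 (ℕ × ℕ)}
    (hb : ∀ k, b k = weight k * w k.2 (lp.single 1 k.1 (1 : ℝ))) (y : Renormed D.nrm) :
    HasSum (fun m => w m (D.R m y)) (D.T b y) := by
  have h0 : HasSum (fun k : ℕ × ℕ => b k • D.v k.1 k.2) (D.T b) := by
    refine ((hasSum_single_one b).mapL D.T).congr_fun fun k => ?_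
    rw [map_smul, Choices.v]
  have h1 : HasSum (fun k : ℕ × ℕ => b k * D.v k.1 k.2 y) (D.T b y) := hasSum_apply_dual h0 y
  have h3 : HasSum (fun k : ℕ × ℕ => b (k.2, k.1) * D.v k.2 k.1 y) (D.T b y) :=
    h1.prod_swap
  refine h3.prod_fiberwise fun m => ?_
  refine ((hasSum_single_one (D.R m y)).mapL (w m)).congr_fun fun n => ?_
  rw [hb, map_smul, R_apply, Choices.Rcoord, smul_eq_mul, weight]
  ring

/-- A supporting functional of `‖·‖ + ‖R ·‖_W` is the sum of a norm-attaining functional and of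
an element `T b`, where the signs of the coordinates `b (n, 0)` are those of `v*_{n,0}`. -/
theorem exists_normAttaining_add_of_supports {F : Renormed D.nrm →ₗ[ℝ] ℝ}
    (hF : ∀ y, F y ≤ ‖y‖ + D.normR y) {y₀ : Renormed D.nrm} (hy₀ : y₀ ≠ 0)
    (hF₀ : F y₀ = ‖y₀‖ + D.normR y₀) :
    ∃ u ∈ normAttaining (Renormed D.nrm), ∃ b : Ell1 (ℕ × ℕ), (∀ y, F y = u y + D.T b y) ∧
      ∃ s : ℝ, 0 < s ∧ ∃ C : ℝ, ∀ n, |D.v n 0 y₀| ≤ C * (1 / 2) ^ n * ‖D.v n 0‖ ∨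
        (b (n, 0) = (1 / 2) ^ n * s ∧ 0 < D.v n 0 y₀ ∨
          b (n, 0) = -((1 / 2) ^ n * s) ∧ D.v n 0 y₀ < 0) := by
  obtain ⟨u, w, hu, hu₀, hw, hw₀, hsum⟩ := D.exists_decomp_of_supports hF hF₀
  obtain ⟨b, hb⟩ := exists_ell1_weight_mul fun m => abs_apply_single_le (hw m)
  have hFT : ∀ y, F y = u y + D.T b y := fun y => by
    linarith [(D.hasSum_apply_R hb y).unique (hsum y)]
  refine ⟨u, mem_normAttaining_of_le hu hy₀ hu₀, b, hFT, ?_⟩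
  obtain ⟨s, hs, C, hC, hsC⟩ := exists_sign_of_supports_phiNorm (D.summable_abs_Phi 0) (D.Phi_pos 0)
    (hw 0) (D.R_ne_zero 0 hy₀) (hw₀ 0)
  have hRn : ∀ n, D.R 0 y₀ n = 1 / 4 * (1 / 2) ^ n * D.v n 0 y₀ := fun n => by
    rw [R_apply, Choices.Rcoord, ← weight_zero, weight]
  have hPhin : ∀ n, D.Φ 0 n = 1 / 4 * (1 / 2) ^ n * ‖D.v n 0‖ := fun n => by
    rw [Choices.Φ, ← weight_zero, weight]
    simp only [Nat.cast_zero, zero_add]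
  have hbn : ∀ n, b (n, 0) = 1 / 4 * (1 / 2) ^ n * w 0 (lp.single 1 n (1 : ℝ)) := fun n => by
    rw [hb, weight_zero]
  refine ⟨s / 4, by positivity, C, fun n => ?_⟩
  have hpos : (0 : ℝ) < 1 / 4 * (1 / 2) ^ n := by positivity
  rcases hsC n with h | ⟨h1, h2⟩ | ⟨h1, h2⟩
  · left
    rw [hRn, hPhin, abs_mul, abs_of_pos hpos] at h
    -- The coordinate of R₀ is linear in the weight 2⁻ⁿ/4 while Φ₀(n)² is quadratic in it, so one
    -- factor 2⁻ⁿ survives the division.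
    have h1 : |D.v n 0 y₀| ≤ C * (1 / 4 * (1 / 2) ^ n) * ‖D.v n 0‖ ^ 2 := by
      refine le_of_mul_le_mul_left ?_ hpos
      linarith
    refine h1.trans ?_
    have h3 := D.norm_v_le n 0
    have h4 : ‖D.v n 0‖ ^ 2 ≤ ‖D.v n 0‖ := by nlinarith [norm_nonneg (D.v n 0)]
    have h5 : (1 / 4 : ℝ) * (1 / 2) ^ n ≤ (1 / 2) ^ n :=
      mul_le_of_le_one_left (by positivity) (by norm_num)
    gcongr
  · right; left
    rw [hRn] at h2
    exact ⟨by rw [hbn, h1]; ring, (mul_pos_iff_of_pos_left hpos).1 h2⟩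
  · right; right
    rw [hRn] at h2
    refine ⟨by rw [hbn, h1]; ring, ?_⟩
    by_contra! h3
    exact absurd h2 (not_lt.2 (mul_nonneg hpos.le h3))

/-- A linear relation between supporting functionals forces a relation between the signs of an
arbitrary functional at the points of support. -/
theorem exists_pos_sum_sign_eq_zero {ι : Type*} [Fintype ι] {F : ι → Renormed D.nrm →ₗ[ℝ] ℝ}
    (hF : ∀ i y, F i y ≤ ‖y‖ + D.normR y) {y : ι → Renormed D.nrm} (hy : ∀ i, y i ≠ 0)
    (hFy : ∀ i, F i (y i) = ‖y i‖ + D.normR (y i)) {a : ι → ℝ} (ha : ∑ i, a i • F i = 0) :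
    ∃ s : ι → ℝ, (∀ i, 0 < s i) ∧ ∀ g : StrongDual ℝ (Renormed D.nrm), (∀ i, g (y i) ≠ 0) →
      ∑ i, a i * (s i * SignType.sign (g (y i))) = 0 := by
  have h1 := fun i => D.exists_normAttaining_add_of_supports (hF i) (hy i) (hFy i)
  choose u hu b hub s hs C hC using h1
  have hG : ∑ i, a i • u i = D.T (-∑ i, a i • b i) := by
    ext z
    have h2 := LinearMap.congr_fun ha z
    rw [LinearMap.sum_apply] at h2
    simp only [LinearMap.smul_apply, hub, LinearMap.zero_apply, smul_eq_mul, mul_add,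
      Finset.sum_add_distrib] at h2
    rw [map_neg, map_sum, neg_apply, sum_apply, sum_apply]
    simp only [map_smul, smul_apply, smul_eq_mul]
    linarith
  have hG0 : ∑ i, a i • u i = 0 := by
    have h2 : ∑ i, a i • u i ∈ normAttaining (Renormed D.nrm) ∩
        (D.Y : Set (StrongDual ℝ (Renormed D.nrm))) :=
      ⟨D.sum_mem_normAttaining a hu, hG ▸ D.T_mem _⟩
    rwa [D.Y_na] at h2
  have hb0 : ∑ i, a i • b i = 0 := by
    rw [hG0] at hG
    have h2 := D.T_injective (hG.symm.trans (map_zero D.T).symm)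
    exact neg_eq_zero.1 h2
  have hbn : ∀ n, ∑ i, a i * b i (n, 0) = 0 := fun n => by
    have h2 := congrArg (lp.evalCLM ℝ (fun _ : ℕ × ℕ => ℝ) 1 (n, 0)) hb0
    rw [map_sum, map_zero] at h2
    rw [← h2]
    refine Finset.sum_congr rfl fun i _ => ?_
    rw [map_smul]
    rfl
  refine ⟨s, hs, fun g hg => ?_⟩
  -- The margin δ, together with n ≥ N below, excludes the alternative in which v*_{n,0}(yᵢ) is
  -- small and its sign is lost.
  obtain ⟨δ, hδ, hδg⟩ : ∃ δ : ℝ, 0 < δ ∧ ∀ i, δ * ‖g‖ < |g (y i)| := by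
    have h2 : ∀ᶠ δ : ℝ in 𝓝[>] 0, ∀ i, δ * ‖g‖ < |g (y i)| := by
      refine eventually_all.2 fun i => ?_
      have h3 : Tendsto (fun δ : ℝ => δ * ‖g‖) (𝓝[>] 0) (𝓝 0) := by
        have : Tendsto (fun δ : ℝ => δ * ‖g‖) (𝓝 0) (𝓝 (0 * ‖g‖)) :=
          tendsto_id.mul_const _
        rw [zero_mul] at this
        exact this.mono_left nhdsWithin_le_nhds
      exact h3.eventually_lt_const (abs_pos.2 (hg i))
    obtain ⟨δ, h3, h4⟩ := (h2.and self_mem_nhdsWithin).exists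
    exact ⟨δ, h4, h3⟩
  obtain ⟨N, hN⟩ : ∃ N : ℕ, ∀ n, N ≤ n → ∀ i, C i * (1 / 2) ^ n < δ := by
    have h2 : ∀ᶠ n : ℕ in atTop, ∀ i, C i * (1 / 2) ^ n < δ := by
      refine eventually_all.2 fun i => ?_
      have h3 := (tendsto_pow_atTop_nhds_zero_of_lt_one (r := (1 / 2 : ℝ)) (by norm_num)
        (by norm_num)).const_mul (C i)
      rw [mul_zero] at h3
      exact h3.eventually_lt_const hδ
    exact eventually_atTop.1 h2
  have hev : ∀ i, Continuous fun f : StrongDual ℝ (Renormed D.nrm) => f (y i) := fun i =>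
    (ContinuousLinearMap.apply ℝ ℝ (y i)).continuous
  -- The open cone consists of the functionals with the signs of g at all yᵢ and with the same
  -- margin.
  obtain ⟨n, hn, hvn⟩ := D.exists_v_mem
    (U := ⋂ i, {f | 0 < f (y i) * g (y i) ∧ δ * ‖f‖ < |f (y i)|})
    (isOpen_iInter_of_finite fun i =>
      (isOpen_lt continuous_const ((hev i).mul continuous_const)).inter
        (isOpen_lt (continuous_const.mul continuous_norm) (hev i).abs))
    ⟨g, Set.mem_iInter.2 fun i => ⟨mul_self_pos.2 (hg i), hδg i⟩⟩
    (fun f hf t ht => Set.mem_iInter.2 fun i => by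
      obtain ⟨h2, h3⟩ := Set.mem_iInter.1 hf i
      change 0 < t * f (y i) * g (y i) ∧ δ * ‖t • f‖ < |t * f (y i)|
      rw [norm_smul, abs_mul, Real.norm_of_nonneg ht.le, abs_of_pos ht]
      exact ⟨by rw [mul_assoc]; exact mul_pos ht h2, by
        rw [mul_left_comm]; exact mul_lt_mul_of_pos_left h3 ht⟩) 0 N
  have hkey : ∀ i, b i (n, 0) = (1 / 2) ^ n * (s i * SignType.sign (g (y i))) := by
    intro i
    obtain ⟨h2, h3⟩ := Set.mem_iInter.1 hvn i
    rcases hC i n with h | ⟨h4, h5⟩ | ⟨h4, h5⟩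
    · have h6 := mul_le_mul_of_nonneg_right (hN n hn i).le (norm_nonneg (D.v n 0))
      exact absurd h3 (not_lt.2 (h.trans h6))
    · have h6 : 0 < g (y i) := (mul_pos_iff_of_pos_left h5).1 h2
      rw [h4, sign_pos h6]
      simp
    · have h6 : g (y i) < 0 := by
        by_contra! h7
        exact absurd h2 (not_lt.2 (mul_nonpos_of_nonpos_of_nonneg h5.le h7))
      rw [h4, sign_neg h6]
      simp
  have h2 := hbn n
  simp only [hkey] at h2
  have h3 : ∑ i, a i * (s i * SignType.sign (g (y i))) =
      2 ^ n * ∑ i, a i * ((1 / 2) ^ n * (s i * SignType.sign (g (y i)))) := by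
    rw [Finset.mul_sum]
    refine Finset.sum_congr rfl fun i _ => ?_
    have h4 : (2 : ℝ) ^ n * (1 / 2) ^ n = 1 := by rw [← mul_pow]; norm_num
    linear_combination -(a i * (s i * SignType.sign (g (y i)))) * h4
  rw [h3, h2, mul_zero]

/-- The functionals supported at three points, the first of which is not a multiple of the
others, satisfy no linear relation involving the first functional. -/
theorem eq_smul_or_eq_smul_of_relation {F : Fin 3 → Renormed D.nrm →ₗ[ℝ] ℝ}
    (hF : ∀ i y, F i y ≤ ‖y‖ + D.normR y) {y : Fin 3 → Renormed D.nrm} (hy : ∀ i, y i ≠ 0)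
    (hFy : ∀ i, F i (y i) = ‖y i‖ + D.normR (y i)) {a : Fin 3 → ℝ} (ha : ∑ i, a i • F i = 0)
    {i j k : Fin 3} (hi : a i ≠ 0) (hij : j ≠ i) (hik : k ≠ i) (hjk : k ≠ j) :
    (∃ c : ℝ, y j = c • y i) ∨ ∃ c : ℝ, y k = c • y i := by
  by_contra! hcon
  obtain ⟨s, hs, hsum⟩ := D.exists_pos_sum_sign_eq_zero hF hy hFy ha
  obtain ⟨h, hhi, hhj, hhk⟩ := exists_apply_eq_zero_apply_ne_zero₂ (hy i) hcon.1 hcon.2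
  obtain ⟨f, hf⟩ := SeparatingDual.exists_eq_one (R := ℝ) (hy i)
  have hall : ∀ l : Fin 3, l ≠ i → h (y l) ≠ 0 := by
    intro l hl
    have : l = j ∨ l = k := by omega
    rcases this with rfl | rfl
    · exact hhj
    · exact hhk
  have hlim : ∀ l : Fin 3, l ≠ i → ∀ᶠ ε : ℝ in 𝓝[>] 0,
      0 < (h (y l) + ε * f (y l)) * h (y l) ∧ 0 < (h (y l) - ε * f (y l)) * h (y l) := by
    intro l hl
    have hc1 : Continuous fun ε : ℝ => (h (y l) + ε * f (y l)) * h (y l) := by fun_prop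
    have hc2 : Continuous fun ε : ℝ => (h (y l) - ε * f (y l)) * h (y l) := by fun_prop
    have h0 : 0 < h (y l) * h (y l) := mul_self_pos.2 (hall l hl)
    have e1 := (hc1.tendsto 0).eventually_const_lt (u := 0) (by simpa using h0)
    have e2 := (hc2.tendsto 0).eventually_const_lt (u := 0) (by simpa using h0)
    exact (e1.and e2).filter_mono nhdsWithin_le_nhds
  -- For small ε the functionals h ± ε f have the sign of h at the two other points and opposite
  -- signs at y i, where h = 0 and f = 1. Subtracting their two sign relations leaves only the term
  -- 2 aᵢ sᵢ.
  obtain ⟨ε, hε, hε0⟩ := ((eventually_all.2 fun l : {l : Fin 3 // l ≠ i} =>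
    hlim l.1 l.2).and self_mem_nhdsWithin).exists
  have hε0' : (0 : ℝ) < ε := hε0
  have sign_eq : ∀ {p q : ℝ}, 0 < p * q → SignType.sign p = SignType.sign q := by
    intro p q hpq
    rcases mul_pos_iff.1 hpq with ⟨h1, h2⟩ | ⟨h1, h2⟩
    · rw [sign_pos h1, sign_pos h2]
    · rw [sign_neg h1, sign_neg h2]
  have happ1 : ∀ z, (h + ε • f) z = h z + ε * f z := fun z => rfl
  have happ2 : ∀ z, (h - ε • f) z = h z - ε * f z := fun z => rfl
  have hg1 := hsum (h + ε • f) fun l => by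
    rw [happ1]
    rcases eq_or_ne l i with rfl | hl
    · rw [hhi, hf, zero_add, mul_one]; exact hε0'.ne'
    · exact left_ne_zero_of_mul (hε ⟨l, hl⟩).1.ne'
  have hg2 := hsum (h - ε • f) fun l => by
    rw [happ2]
    rcases eq_or_ne l i with rfl | hl
    · rw [hhi, hf, zero_sub, mul_one]; exact neg_ne_zero.2 hε0'.ne'
    · exact left_ne_zero_of_mul (hε ⟨l, hl⟩).2.ne'
  have hsub : ∑ l, (a l * (s l * SignType.sign ((h + ε • f) (y l))) -
      a l * (s l * SignType.sign ((h - ε • f) (y l)))) = 0 := by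
    rw [Finset.sum_sub_distrib, hg1, hg2, sub_zero]
  rw [Finset.sum_eq_single i] at hsub
  · rw [happ1, happ2, hhi, hf, mul_one, zero_add, zero_sub, sign_pos hε0',
      sign_neg (neg_lt_zero.2 hε0')] at hsub
    have h1 : a i * s i = 0 := by
      simp at hsub
      exact mul_eq_zero.2 hsub
    exact (mul_ne_zero hi (hs i).ne') h1
  · intro l _ hl
    rw [happ1, happ2, sign_eq (hε ⟨l, hl⟩).1, sign_eq (hε ⟨l, hl⟩).2, sub_self]
  · simp

/-! ### Two-dimensional quotients of 𝕏 -/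

/-- The identity from `𝕏` to `(c₀, nrm)`. -/
noncomputable def toNrm : D.X ≃ₗ[ℝ] Renormed D.nrm :=
  (Renormed.toBaseₗ D.p).trans (Renormed.toBaseₗ D.nrm).symm

theorem norm_X (x : D.X) : ‖x‖ = ‖D.toNrm x‖ + D.normR (D.toNrm x) := rfl

theorem eq_smul_or_eq_smul {x : Fin 3 → D.X} (hx : ∀ i, ‖x i‖ = 1) {f : Fin 3 → StrongDual ℝ D.X}
    (hf : ∀ i, ‖f i‖ = 1) (hfx : ∀ i, f i (x i) = 1) {a : Fin 3 → ℝ} (ha : ∑ i, a i • f i = 0)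
    {i j k : Fin 3} (hi : a i ≠ 0) (hij : j ≠ i) (hik : k ≠ i) (hjk : k ≠ j) :
    (∃ c : ℝ, x j = c • x i) ∨ ∃ c : ℝ, x k = c • x i := by
  have key := D.eq_smul_or_eq_smul_of_relation
    (F := fun i => (f i : D.X →ₗ[ℝ] ℝ) ∘ₗ (D.toNrm.symm : Renormed D.nrm →ₗ[ℝ] D.X))
    (y := fun i => D.toNrm (x i)) (a := a) (fun i y => by
      have h1 := (f i).le_opNorm (D.toNrm.symm y)
      rw [hf, one_mul, norm_X, LinearEquiv.apply_symm_apply] at h1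
      exact (le_abs_self _).trans h1)
    (fun i h => by
      rw [LinearEquiv.map_eq_zero_iff] at h
      have h1 := hx i
      rw [h, norm_zero] at h1
      exact zero_ne_one h1)
    (fun i => by
      rw [← norm_X, hx, ← hfx i]
      simp)
    (by
      ext y
      have h1 := DFunLike.congr_fun ha (D.toNrm.symm y)
      rw [sum_apply] at h1
      rw [LinearMap.sum_apply]
      exact h1) hi hij hik hjk
  refine key.imp ?_ ?_ <;>
  · rintro ⟨c, hc⟩
    exact ⟨c, D.toNrm.injective (by rw [hc, map_smul])⟩

/-- Hahn-Banach in the quotient. The pullback keeps norm one because it takes the value 1 at x,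
which has norm one itself. -/
theorem exists_supporting_of_mkQ {E : Type*} [NormedAddCommGroup E] [NormedSpace ℝ E]
    (M : Submodule ℝ E) {x : E} (hx : ‖x‖ ≤ 1) (hq : ‖M.mkQ x‖ = 1) :
    ‖x‖ = 1 ∧ ∃ g : StrongDual ℝ (E ⧸ M), ‖g.comp M.mkQL‖ = 1 ∧ g (M.mkQ x) = 1 := by
  have hle : ∀ y : E, ‖M.mkQ y‖ ≤ ‖y‖ := fun y => Submodule.Quotient.norm_mk_le M y
  have hx1 : ‖x‖ = 1 := le_antisymm hx (hq ▸ hle x)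
  obtain ⟨g, hg, hgx⟩ := exists_dual_vector ℝ (M.mkQ x) (by rw [hq]; exact one_ne_zero)
  have hgx1 : g (M.mkQ x) = 1 := by rw [hgx, hq]; rfl
  refine ⟨hx1, g, le_antisymm ?_ ?_, hgx1⟩
  · refine ContinuousLinearMap.opNorm_le_bound _ zero_le_one fun y => ?_
    have h1 := g.le_opNorm (M.mkQ y)
    rw [hg] at h1
    exact h1.trans (mul_le_mul_of_nonneg_left (hle y) zero_le_one)
  · have h1 := (g.comp M.mkQL).le_opNorm x
    rw [hx1, mul_one] at h1
    change ‖g (M.mkQ x)‖ ≤ _ at h1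
    rwa [hgx1, norm_one] at h1

/-- Among three points of the unit ball whose classes have norm one, two agree up to sign. -/
theorem exists_eq_or_eq_neg (M : Submodule ℝ D.X) (hM : Module.finrank ℝ (D.X ⧸ M) = 2)
    {x : Fin 3 → D.X} (hx : ∀ i, ‖x i‖ ≤ 1) (hq : ∀ i, ‖M.mkQ (x i)‖ = 1) :
    ∃ i j, j ≠ i ∧ (x j = x i ∨ x j = -x i) := by
  have h1 := fun i => exists_supporting_of_mkQ M (hx i) (hq i)
  choose hx1 g hg hgx using h1
  have : Module.Finite ℝ (D.X ⧸ M) := Module.finite_of_finrank_pos (by omega)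
  -- Three functionals on a two-dimensional space are dependent; this is where codimension two
  -- enters.
  have hdep : ¬ LinearIndependent ℝ fun i => (g i : Module.Dual ℝ (D.X ⧸ M)) := fun h => by
    have h2 := h.fintype_card_le_finrank
    rw [Subspace.dual_finrank_eq, hM, Fintype.card_fin] at h2
    omega
  obtain ⟨a, ha, i, hi⟩ := Fintype.not_linearIndependent_iff.1 hdep
  have hrel : ∑ i, a i • (g i).comp M.mkQL = 0 := by
    ext y
    have h2 := LinearMap.congr_fun ha (M.mkQ y)
    rw [LinearMap.sum_apply] at h2
    rw [sum_apply]
    exact h2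
  have hpm : ∀ j, (∃ c : ℝ, x j = c • x i) → x j = x i ∨ x j = -x i := by
    rintro j ⟨c, hc⟩
    have h2 := hx1 j
    rw [hc, norm_smul, hx1, mul_one, Real.norm_eq_abs] at h2
    rcases (abs_eq zero_le_one).1 h2 with rfl | rfl
    · left; rw [hc, one_smul]
    · right; rw [hc, neg_one_smul]
  obtain ⟨j, k, hij, hik, hjk⟩ : ∃ j k : Fin 3, j ≠ i ∧ k ≠ i ∧ k ≠ j := by
    clear * -
    revert i
    decide
  rcases D.eq_smul_or_eq_smul hx1 hg hgx hrel hi hij hik hjk with h | h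
  · exact ⟨i, j, hij, hpm j h⟩
  · exact ⟨i, k, hik, hpm k h⟩

/-- The points of the unit ball at which the quotient map attains its norm. -/
theorem eq_empty_or_subset_pair (M : Submodule ℝ D.X) (hM : Module.finrank ℝ (D.X ⧸ M) = 2) :
    {x : D.X | ‖x‖ ≤ 1 ∧ ‖M.mkQ x‖ = 1} = ∅ ∨
      ∃ x₁ ∈ {x : D.X | ‖x‖ ≤ 1 ∧ ‖M.mkQ x‖ = 1}, ∃ x₂ ∈ {x : D.X | ‖x‖ ≤ 1 ∧ ‖M.mkQ x‖ = 1},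
        {x : D.X | ‖x‖ ≤ 1 ∧ ‖M.mkQ x‖ = 1} ⊆ {x₁, x₂, -x₁, -x₂} := by
  set S := {x : D.X | ‖x‖ ≤ 1 ∧ ‖M.mkQ x‖ = 1} with hS
  rcases S.eq_empty_or_nonempty with h | ⟨x₁, h₁⟩
  · exact Or.inl h
  right
  refine ⟨x₁, h₁, ?_⟩
  by_cases h : ∃ x₂ ∈ S, x₂ ≠ x₁ ∧ x₂ ≠ -x₁
  · obtain ⟨x₂, h₂, hne, hne'⟩ := h
    refine ⟨x₂, h₂, fun x hx => ?_⟩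
    have hmem : ∀ i, (![x₁, x₂, x] : Fin 3 → D.X) i ∈ S := by
      intro i
      fin_cases i
      · exact h₁
      · exact h₂
      · exact hx
    obtain ⟨i, j, hij, hor⟩ := D.exists_eq_or_eq_neg M hM (fun i => (hmem i).1)
      (fun i => (hmem i).2)
    have hne'' : x₁ ≠ -x₂ := fun h => hne' (by rw [h, neg_neg])
    simp only [Set.mem_insert_iff, Set.mem_singleton_iff]
    have hsymm : ∀ y : D.X, y = -x → x = -y := fun y h => by rw [h, neg_neg]
    fin_cases i <;> fin_cases j <;> simp at hij hor
    · exact absurd hor (by simp [hne, hne'])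
    · tauto
    · exact absurd hor (by simp [hne.symm, hne''])
    · tauto
    · rcases hor with h | h
      · exact Or.inl h.symm
      · exact Or.inr (Or.inr (Or.inl (hsymm _ h)))
    · rcases hor with h | h
      · exact Or.inr (Or.inl h.symm)
      · exact Or.inr (Or.inr (Or.inr (hsymm _ h)))
  · push Not at h
    refine ⟨x₁, h₁, fun x hx => ?_⟩
    simp only [Set.mem_insert_iff, Set.mem_singleton_iff]
    by_cases hxx : x = x₁
    · exact Or.inl hxx
    · exact Or.inr (Or.inr (Or.inl (h x hx hxx)))

end Choices

/-- If m is nearest to x, then x - m has the same norm as its class, which is the class of x.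
Normalising x - m gives z. -/
theorem mkQ_mem_span_of_nearestPoints {E : Type*} [NormedAddCommGroup E] [NormedSpace ℝ E]
    {M : Submodule ℝ E} {x : E} (hx : x ∉ M)
    (hP : (nearestPoints M x).Nonempty) :
    ∃ z ∈ {z : E | ‖z‖ ≤ 1 ∧ ‖M.mkQ z‖ = 1}, M.mkQ x ∈ Submodule.span ℝ {M.mkQ z} := by
  obtain ⟨m, hm, hdist⟩ := hP
  have hq : ‖M.mkQ x‖ = ‖x - m‖ := by
    rw [hdist]
    exact QuotientAddGroup.norm_mk (S := M.toAddSubgroup) x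
  have hpos : 0 < ‖x - m‖ := norm_pos_iff.2 fun h => hx (sub_eq_zero.1 h ▸ hm)
  have hxm : M.mkQ (x - m) = M.mkQ x := by
    rw [map_sub, Submodule.mkQ_apply M m, (Submodule.Quotient.mk_eq_zero M).2 hm, sub_zero]
  refine ⟨‖x - m‖⁻¹ • (x - m), ⟨?_, ?_⟩, ?_⟩
  · rw [norm_smul, norm_inv, norm_norm, inv_mul_cancel₀ hpos.ne']
  · rw [map_smul, hxm, norm_smul, norm_inv, norm_norm, hq, inv_mul_cancel₀ hpos.ne']
  · rw [map_smul, hxm]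
    refine Submodule.mem_span_singleton.2 ⟨‖x - m‖, smul_inv_smul₀ hpos.ne' _⟩

theorem encard_le_four_of_subset {α : Type*} {s : Set α} {a b c d : α} (h : s ⊆ {a, b, c, d}) :
    s.encard ≤ 4 := by
  classical
  refine (Set.encard_le_encard h).trans ?_
  have h1 : ({a, b, c, d} : Set α) = (({a, b, c, d} : Finset α) : Set α) := by simp
  rw [h1, Set.encard_coe_eq_coe_finsetCard]
  exact_mod_cast Finset.card_le_four

end AlgTrivNA

theorem mainTheorem3 :
    Nonempty AlgTrivNA.Choices ∧
    ∀ (D : AlgTrivNA.Choices) (M : Submodule ℝ D.X),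
      IsClosed (M : Set D.X) → Module.finrank ℝ (D.X ⧸ M) = 2 →
        (∃ x₁ ∈ Metric.closedBall (0 : D.X) 1, ∃ x₂ ∈ Metric.closedBall (0 : D.X) 1,
          {x : D.X | x ∈ Metric.closedBall (0 : D.X) 1 ∧
              M.mkQ x ∈ Metric.sphere (0 : D.X ⧸ M) 1} ⊆ {x₁, x₂, -x₁, -x₂}) ∧
        (∃ x₁ ∈ Metric.closedBall (0 : D.X) 1, ∃ x₂ ∈ Metric.closedBall (0 : D.X) 1,
          M.mkQ '' Metric.closedBall (0 : D.X) 1 ∩ Metric.sphere (0 : D.X ⧸ M) 1 ⊆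
            {M.mkQ x₁, M.mkQ x₂, -M.mkQ x₁, -M.mkQ x₂}) ∧
        (M.mkQ '' Metric.closedBall (0 : D.X) 1 ∩ Metric.sphere (0 : D.X ⧸ M) 1).encard ≤ 4 ∧
        (∃ x₁ x₂ : D.X, x₁ ∉ M ∧ x₂ ∉ M ∧
          {q : D.X ⧸ M | ∃ x : D.X, x ∉ M ∧ (AlgTrivNA.nearestPoints M x).Nonempty ∧
              M.mkQ x = q} ⊆
            (Submodule.span ℝ {M.mkQ x₁} : Set (D.X ⧸ M)) ∪
              (Submodule.span ℝ {M.mkQ x₂} : Set (D.X ⧸ M))) := by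
  refine ⟨AlgTrivNA.nonempty_choices, fun D M _ hrank => ?_⟩
  have hS := D.eq_empty_or_subset_pair M hrank
  set S := {x : D.X | ‖x‖ ≤ 1 ∧ ‖M.mkQ x‖ = 1} with hSdef
  have hSeq : {x : D.X | x ∈ Metric.closedBall (0 : D.X) 1 ∧
      M.mkQ x ∈ Metric.sphere (0 : D.X ⧸ M) 1} = S := by
    ext x
    simp only [Set.mem_ofPred_eq, mem_closedBall_zero_iff, mem_sphere_zero_iff_norm, hSdef]
  have ha : ∃ x₁ ∈ Metric.closedBall (0 : D.X) 1, ∃ x₂ ∈ Metric.closedBall (0 : D.X) 1,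
      S ⊆ {x₁, x₂, -x₁, -x₂} := by
    rcases hS with h | ⟨x₁, h₁, x₂, h₂, h⟩
    · have h0 : (0 : D.X) ∈ Metric.closedBall (0 : D.X) 1 := Metric.mem_closedBall_self zero_le_one
      exact ⟨0, h0, 0, h0, h ▸ Set.empty_subset _⟩
    · exact ⟨x₁, mem_closedBall_zero_iff.2 h₁.1, x₂, mem_closedBall_zero_iff.2 h₂.1, h⟩
  have hb : ∃ x₁ ∈ Metric.closedBall (0 : D.X) 1, ∃ x₂ ∈ Metric.closedBall (0 : D.X) 1,
      M.mkQ '' Metric.closedBall (0 : D.X) 1 ∩ Metric.sphere (0 : D.X ⧸ M) 1 ⊆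
        {M.mkQ x₁, M.mkQ x₂, -M.mkQ x₁, -M.mkQ x₂} := by
    obtain ⟨x₁, h₁, x₂, h₂, h⟩ := ha
    refine ⟨x₁, h₁, x₂, h₂, ?_⟩
    rintro _ ⟨⟨x, hx, rfl⟩, hq⟩
    have hxS : x ∈ S := hSeq ▸ ⟨hx, hq⟩
    rcases h hxS with rfl | rfl | rfl | rfl <;> simp
  refine ⟨hSeq ▸ ha, hb, ?_, ?_⟩
  · obtain ⟨x₁, -, x₂, -, h⟩ := hb
    exact AlgTrivNA.encard_le_four_of_subset h
  · rcases hS with hS | ⟨x₁, h₁, x₂, h₂, h⟩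
    -- Here no point outside M has a nearest point in M, but witnesses outside M are still required;
    -- the quotient is non-trivial.
    · have hne : ∃ x : D.X, x ∉ M := by
        by_contra! hall
        have hsub : Subsingleton (D.X ⧸ M) :=
          Submodule.Quotient.subsingleton_iff.2 (Submodule.eq_top_iff'.2 hall)
        rw [Module.finrank_zero_of_subsingleton] at hrank
        omega
      obtain ⟨x₀, h₀⟩ := hne
      refine ⟨x₀, x₀, h₀, h₀, ?_⟩
      rintro _ ⟨x, hx, hP, rfl⟩
      obtain ⟨z, hz, -⟩ := AlgTrivNA.mkQ_mem_span_of_nearestPoints hx hP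
      have hzS : z ∈ S := hz
      rw [hS] at hzS
      exact absurd hzS (Set.notMem_empty z)
    · have hnot : ∀ z ∈ S, z ∉ M := fun z hz hzM => by
        have h3 := hz.2
        rw [Submodule.mkQ_apply, (Submodule.Quotient.mk_eq_zero M).2 hzM, norm_zero] at h3
        exact zero_ne_one h3
      refine ⟨x₁, x₂, hnot x₁ h₁, hnot x₂ h₂, ?_⟩
      rintro _ ⟨x, hx, hP, rfl⟩
      obtain ⟨z, hz, hzx⟩ := AlgTrivNA.mkQ_mem_span_of_nearestPoints hx hP
      have hzS : z ∈ S := hz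
      rcases h hzS with rfl | rfl | rfl | rfl
      · exact Or.inl hzx
      · exact Or.inr hzx
      · left
        rw [map_neg, ← Set.neg_singleton, Submodule.span_neg] at hzx
        exact hzx
      · right
        rw [map_neg, ← Set.neg_singleton, Submodule.span_neg] at hzx
        exact hzx
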